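/- Let $A\in\mathbb R^{n\times n}$, $B\in\mathbb R^{n\times m}$, $C\in\mathbb R^{p\times n}$ and let $F\in\mathbb R^{r\times n}$ have full row rank; consider the system $\dot x=Ax+Bu$, $y=Cx$, $z=Fx$ on $[0,\infty)$. For a matrix $M$ with $n$ columns let $\mathcal O_{(A,M)}$ be the matrix with blocks $M,MA,\dots,MA^{n-1}$ stacked, and let $\mathcal V_F=\operatorname{Im}\mathcal O_{(A,F)}^{\mathsf T}=\operatorname{Im}\begin{pmatrix}F^{\mathsf T}&A^{\mathsf T}F^{\mathsf T}&\cdots&(A^{\mathsf T})^{n-1}F^{\mathsf T}\end{pmatrix}$. For $\bar F\in\mathbb R^{d\times n}$ the *controller rank conditions* are $$\operatorname{rank}\begin{pmatrix}\bar FA\\ \bar F\end{pmatrix}=\operatorname{rank}\bar F,\qquad \operatorname{rank}\begin{pmatrix}\lambda\bar F-\bar FA&\bar FB\end{pmatrix}=\operatorname{rank}\bar F\quad\forall\lambda\in\mathbb C ,$$ and for a matrix $R$ with $n$ columns the *observer rank conditions* are $$\operatorname{rank}\begin{pmatrix}FA\\RA\\CA\\C\\F\\R\end{pmatrix}=\operatorname{rank}\begin{pmatrix}CA\\C\\F\\R\end{pmatrix},\qquad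 \operatorname{rank}\begin{pmatrix}\lambda F-FA\\ \lambda R-RA\\CA\\C\end{pmatrix}=\operatorname{rank}\begin{pmatrix}CA\\C\\F\\R\end{pmatrix}\quad\forall\lambda\in\mathbb C .$$ Suppose that 1. $(A,B,F^{\mathsf T})$ is intrinsically functionally controllable: there are $d\in\{r,\dots,n\}$ and $R_1\in\mathbb R^{(d-r)\times n}$ such that $\bar F=\begin{pmatrix}F\\R_1\end{pmatrix}$ has rank $d$ and satisfies the controller rank conditions; and 2. $(A,C,F)$ is functionally observable: $\operatorname{rank}\begin{pmatrix}\mathcal O_{(A,C)}\\ \mathcal O_{(A,F)}\end{pmatrix}=\operatorname{rank}\mathcal O_{(A,C)}$. Then there are matrices $R_1,R_2$ (possibly empty), with $r$ plus their numbers of rows at most $n$, such that $\bar F=\begin{pmatrix}F\\R_1\end{pmatrix}$ has full row rank and satisfies the controller rank conditions and $R=\begin{pmatrix}R_1\\R_2\end{pmatrix}$ satisfies the observer rank conditions. Explicitly: (a) Rows of $\mathcal O_{(A,F)}$ can be selected that together with the rows of $F$ form a basis of the row space of $\mathcal O_{(A,F)}$. For every such selection $R_1$, the matrix $\bar F=\begin{pmatrix}F\\R_1\end{pmatrix}$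 has full row rank $d=\dim\mathcal V_F$, $\operatorname{Im}\bar F^{\mathsf T}=\mathcal V_F$, and $\bar F$ satisfies the controller rank conditions. (b) There is an invertible $T$ with $$T^{-1}AT=\begin{pmatrix}A_o&0\\A_{21}&A_u\end{pmatrix},\qquad CT=\begin{pmatrix}C_o&0\end{pmatrix},\qquad A_o\in\mathbb R^{h\times h},\ (A_o,C_o)\text{ observable}.$$ For every such $T$ and every $R_1$ as in (a), $\bar FT=\begin{pmatrix}\bar F_o&0\end{pmatrix}$ with $\bar F_o\in\mathbb R^{d\times h}$ of rank $d$, and there is a matrix $\bar F_o^{\perp}$ whose rows complete those of $\bar F_o$ to a basis of $\mathbb R^h$. For every such $\bar F_o^{\perp}$, with $R_2=\begin{pmatrix}\bar F_o^{\perp}&0\end{pmatrix}T^{-1}$, the matrix $R=\begin{pmatrix}R_1\\R_2\end{pmatrix}$ satisfies the observer rank conditions, and there is a functional observer of $\bar Fx$ whose order $q$ is the number of rows of $\begin{pmatrix}F\\R_1\\R_2\end{pmatrix}$. Here a functional observer of $\bar Fx$ of order $q$ is a system $\dot w=Nw+Jy+Hu$ with $w(t)\in\mathbb R^q$ and output $\hat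 z=Dw+Ey\in\mathbb R^d$ such that $\hat z(t)-\bar Fx(t)\to0$ as $t\to\infty$ for every continuous input and all initial conditions $x(0),w(0)$; so the first $r$ components of $\hat z$ estimate $z=Fx$. In (b), $N,J,D,E$ and a matrix $P$ can be chosen independently of $B$, with $H=PB$. (c) For every $R_1$ as in (a) there is a gain $K\in\mathbb R^{m\times d}$ for which $u=-K\bar Fx$ drives $\bar Fx(t)\to0$ from every initial condition (a condition that involves only $A,B,\bar F$). The controller and the observer can be designed independently: for every such $K$ and every functional observer of $\bar Fx$ (of any order), the closed loop with the static law $u=-K\hat z$ has a solution on $[0,\infty)$ for all initial conditions $x(0),w(0)$, and every solution satisfies $z(t)=Fx(t)\to0$ as $t\to\infty$. -/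

import Mathlib

open Matrix Filter Topology

namespace GSP

/-- The controllability matrix `(B, A B, …, A^(n-1) B)`; the column `(k, j)` is the `j`-th
column of `A^k B`. -/
def ctrbMatrix {n m : ℕ} (A : Matrix (Fin n) (Fin n) ℝ) (B : Matrix (Fin n) (Fin m) ℝ) :
    Matrix (Fin n) (Fin n × Fin m) ℝ :=
  Matrix.of fun i kj => (A ^ (kj.1 : ℕ) * B) i kj.2

/-- The observability matrix `(C; C A; …; C A^(n-1))`; the row `(k, i)` is the `i`-th
row of `C A^k`. -/
def obsMatrix {n p : ℕ} (A : Matrix (Fin n) (Fin n) ℝ) (C : Matrix (Fin p) (Fin n) ℝ) :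
    Matrix (Fin n × Fin p) (Fin n) ℝ :=
  Matrix.of fun ki j => (C * A ^ (ki.1 : ℕ)) ki.2 j

/-- The intrinsic functional subspace: the image of the controllability matrix of the pair
`(Aᵀ, Fᵀ)`. -/
def intrinsicSubspace {n r : ℕ} (A : Matrix (Fin n) (Fin n) ℝ) (F : Matrix (Fin r) (Fin n) ℝ) :
    Submodule ℝ (Fin n → ℝ) :=
  LinearMap.range (ctrbMatrix Aᵀ Fᵀ).mulVecLin

/-- The two controller rank conditions for a completed functional `Fb`:
`rank (Fb A; Fb) = rank Fb`, and `rank (s Fb - Fb A, Fb B) = rank Fb` for all complex `s`. -/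
def ControllerRankConditions {n m : ℕ} {ι : Type} (A : Matrix (Fin n) (Fin n) ℝ)
    (B : Matrix (Fin n) (Fin m) ℝ) (Fb : Matrix ι (Fin n) ℝ) : Prop :=
  (fromRows (Fb * A) Fb).rank = Fb.rank ∧
  ∀ s : ℂ,
    (fromCols (s • Fb.map Complex.ofReal - (Fb * A).map Complex.ofReal)
      ((Fb * B).map Complex.ofReal)).rank = Fb.rank

/-- Intrinsic functional controllability of `(A, B, Fᵀ)`: the functional `F` has a completion
`(F; R₁)` with `d = r + k ≤ n` rows, of full row rank, that satisfies the controller rank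
conditions. -/
def IsIntrinsicallyFunctionallyControllable {n m r : ℕ} (A : Matrix (Fin n) (Fin n) ℝ)
    (B : Matrix (Fin n) (Fin m) ℝ) (F : Matrix (Fin r) (Fin n) ℝ) : Prop :=
  ∃ (k : ℕ) (R₁ : Matrix (Fin k) (Fin n) ℝ), r + k ≤ n ∧ (fromRows F R₁).rank = r + k ∧
    ControllerRankConditions A B (fromRows F R₁)

/-- Functional observability of `(A, C, F)`: stacking the observability matrix of `(A, F)` under
that of `(A, C)` does not increase the rank. -/
def IsFunctionallyObservable {n p r : ℕ} (A : Matrix (Fin n) (Fin n) ℝ)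
    (C : Matrix (Fin p) (Fin n) ℝ) (F : Matrix (Fin r) (Fin n) ℝ) : Prop :=
  (fromRows (obsMatrix A C) (obsMatrix A F)).rank = (obsMatrix A C).rank

/-- The two observer rank conditions for the functional `F` augmented by the rows of `R`:
`rank (F A; R A; C A; C; F; R) = rank (C A; C; F; R)`, and
`rank (s F - F A; s R - R A; C A; C) = rank (C A; C; F; R)` for all complex `s`. -/
def ObserverRankConditions {n p r : ℕ} {ι : Type} (A : Matrix (Fin n) (Fin n) ℝ)
    (C : Matrix (Fin p) (Fin n) ℝ) (F : Matrix (Fin r) (Fin n) ℝ)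
    (R : Matrix ι (Fin n) ℝ) : Prop :=
  (fromRows (F * A) (fromRows (R * A) (fromRows (C * A) (fromRows C (fromRows F R))))).rank =
      (fromRows (C * A) (fromRows C (fromRows F R))).rank ∧
  ∀ s : ℂ,
    (fromRows (s • F.map Complex.ofReal - (F * A).map Complex.ofReal)
      (fromRows (s • R.map Complex.ofReal - (R * A).map Complex.ofReal)
        (fromRows ((C * A).map Complex.ofReal) (C.map Complex.ofReal)))).rank =
      (fromRows (C * A) (fromRows C (fromRows F R))).rank

/-- The rows of `M` form a basis of the subspace `V`. -/
def RowsFormBasis {n : ℕ} {ι : Type} (M : Matrix ι (Fin n) ℝ)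
    (V : Submodule ℝ (Fin n → ℝ)) : Prop :=
  LinearIndependent ℝ M.row ∧ Submodule.span ℝ (Set.range M.row) = V

/-- `R₁` consists of rows selected from the observability matrix of `(A, F)`, which together with
the rows of `F` form a basis of the row space of that observability matrix. -/
def IsRowBasisCompletion {n r k : ℕ} (A : Matrix (Fin n) (Fin n) ℝ)
    (F : Matrix (Fin r) (Fin n) ℝ) (R₁ : Matrix (Fin k) (Fin n) ℝ) : Prop :=
  (∃ σ : Fin k → Fin n × Fin r, R₁ = (obsMatrix A F).submatrix σ id) ∧
  RowsFormBasis (fromRows F R₁) (Submodule.span ℝ (Set.range (obsMatrix A F).row))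

/-- Kalman observability decomposition: `T` is invertible with inverse `S`,
`S A T = (Ao, 0; A₂₁, Au)`, `C T = (Co, 0)`, and the pair `(Ao, Co)` is observable. -/
structure IsKalmanObsDecomposition {n p h l : ℕ} (A : Matrix (Fin n) (Fin n) ℝ)
    (C : Matrix (Fin p) (Fin n) ℝ) (T : Matrix (Fin n) (Fin h ⊕ Fin l) ℝ)
    (S : Matrix (Fin h ⊕ Fin l) (Fin n) ℝ) (Ao : Matrix (Fin h) (Fin h) ℝ)
    (A₂₁ : Matrix (Fin l) (Fin h) ℝ) (Au : Matrix (Fin l) (Fin l) ℝ)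
    (Co : Matrix (Fin p) (Fin h) ℝ) : Prop where
  mul_inv : T * S = 1
  inv_mul : S * T = 1
  state : S * A * T = fromBlocks Ao 0 A₂₁ Au
  output : C * T = fromCols Co 0
  observable : (obsMatrix Ao Co).rank = h

/-- `x` is a solution on `[0, ∞)` of `x' = A x + B u`. -/
def IsTrajectory {n m : ℕ} (A : Matrix (Fin n) (Fin n) ℝ) (B : Matrix (Fin n) (Fin m) ℝ)
    (u : ℝ → Fin m → ℝ) (x : ℝ → Fin n → ℝ) : Prop :=
  ∀ t, 0 ≤ t → HasDerivWithinAt x (A *ᵥ x t + B *ᵥ u t) (Set.Ici 0) t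

/-- A linear observer of order `q`, driven by the output `y` and the input `u`:
`w' = N w + J y + H u`, with estimate `D w + E y`. -/
structure LinearObserver (q p m : ℕ) (ι : Type) where
  N : Matrix (Fin q) (Fin q) ℝ
  J : Matrix (Fin q) (Fin p) ℝ
  H : Matrix (Fin q) (Fin m) ℝ
  D : Matrix ι (Fin q) ℝ
  E : Matrix ι (Fin p) ℝ

/-- The estimate `D w + E y` that the observer produces. -/
def LinearObserver.estimate {q p m : ℕ} {ι : Type} (O : LinearObserver q p m ι)
    (w : Fin q → ℝ) (y : Fin p → ℝ) : ι → ℝ :=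
  O.D *ᵥ w + O.E *ᵥ y

/-- `w` is a solution on `[0, ∞)` of the observer equation `w' = N w + J y + H u`. -/
def LinearObserver.IsRun {q p m : ℕ} {ι : Type} (O : LinearObserver q p m ι)
    (y : ℝ → Fin p → ℝ) (u : ℝ → Fin m → ℝ) (w : ℝ → Fin q → ℝ) : Prop :=
  ∀ t, 0 ≤ t →
    HasDerivWithinAt w (O.N *ᵥ w t + O.J *ᵥ y t + O.H *ᵥ u t) (Set.Ici 0) t

/-- `O` is a functional observer of `G x` for the system `x' = A x + B u`, `y = C x`: for every
input, every initial state of the system and every initial state of the observer, the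
estimation error tends to zero. -/
def IsFunctionalObserver {n m p q : ℕ} {ι : Type} (A : Matrix (Fin n) (Fin n) ℝ)
    (B : Matrix (Fin n) (Fin m) ℝ) (C : Matrix (Fin p) (Fin n) ℝ) (G : Matrix ι (Fin n) ℝ)
    (O : LinearObserver q p m ι) : Prop :=
  ∀ (u : ℝ → Fin m → ℝ) (x : ℝ → Fin n → ℝ) (w : ℝ → Fin q → ℝ),
    ContinuousOn u (Set.Ici 0) → IsTrajectory A B u x → O.IsRun (fun t => C *ᵥ x t) u w →
    Tendsto (fun t => O.estimate (w t) (C *ᵥ x t) - G *ᵥ x t) atTop (𝓝 0)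

/-- `K` is the gain of a functional controller of `G x` for `x' = A x + B u`: the static
functional state feedback `u = -K G x` drives `G x` to zero from every initial state. -/
def IsFunctionalController {n m : ℕ} {ι : Type} [Fintype ι] (A : Matrix (Fin n) (Fin n) ℝ)
    (B : Matrix (Fin n) (Fin m) ℝ) (G : Matrix ι (Fin n) ℝ) (K : Matrix (Fin m) ι ℝ) : Prop :=
  ∀ x : ℝ → Fin n → ℝ, IsTrajectory A B (fun t => -(K *ᵥ (G *ᵥ x t))) x →
    Tendsto (fun t => G *ᵥ x t) atTop (𝓝 0)

/-- `(x, w)` is a solution on `[0, ∞)` of the closed loop formed by the system `x' = A x + B u`,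
`y = C x`, the observer `O`, and the static law `u = -K ẑ`, where `ẑ` is the estimate that the
observer produces. -/
def IsClosedLoopSolution {n m p q : ℕ} {ι : Type} [Fintype ι] (A : Matrix (Fin n) (Fin n) ℝ)
    (B : Matrix (Fin n) (Fin m) ℝ) (C : Matrix (Fin p) (Fin n) ℝ) (K : Matrix (Fin m) ι ℝ)
    (O : LinearObserver q p m ι) (x : ℝ → Fin n → ℝ) (w : ℝ → Fin q → ℝ) : Prop :=
  IsTrajectory A B (fun t => -(K *ᵥ O.estimate (w t) (C *ᵥ x t))) x ∧
  O.IsRun (fun t => C *ᵥ x t) (fun t => -(K *ᵥ O.estimate (w t) (C *ᵥ x t))) w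

end GSP

open GSP

/-! The row space `V` of `obsMatrix A F` is the smallest subspace that contains the rows of `F` and
is invariant under `v ↦ v A`. Let the rows of `Fb` form a basis of `V`. Then `Fb A = M Fb`, so `Fb
x` is the state of a system of its own, with matrices `M` and `Fb B`.

Controller: the row space of the given completion `Fh` is invariant, hence contains `V`, and `Fb = L
Fh`. A left null vector `v` of the pencil of `Fb` yields the null vector `v L` of the pencil of
`Fh`, which is zero; independence of the rows of `Fb` gives `v = 0`
(`controllerRankConditions_of_span_eq`).

Observer: functional observability says that `V` annihilates the unobservable subspace. In Kalman
coordinates, with `Z` the first `h` rows of `S`, one has `Z A = Ao Z`, and `Fb`, `C`, `R` all factor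
through `Z`. Once the rows are completed to a basis of `ℝ^h`, both observer conditions say rank `h`;
the pencil condition reduces to the Hautus test for `(Ao, Co)` (`observerRankConditions_of_mul`). A
Luenberger observer of `Z x` has order `h`.

Separation: under `u = -K ẑ` the functional obeys `(Fb x)' = (M - Fb B K) Fb x - Fb B K e`, where
`e` is the estimation error. The homogeneous part is stable by the choice of `K`, and `e → 0`, so
`tendsto_zero_of_vanishing_perturbation` concludes. Only `e → 0` is asked of the observer. Both
gains come from the Lyapunov inequality `exists_lyapunov`. -/

namespace GSP

/-! ### Rank, kernels and row spaces -/

section RankLemmas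

variable {K : Type*} [Field K] {ι κ l : Type*}

theorem rank_eq_card_of_vecMul_eq_zero [Fintype ι] [Fintype κ] (M : Matrix ι κ K) (h : ∀ v, v ᵥ* M = 0 → v = 0) :
    M.rank = Fintype.card ι := by
  refine LinearIndependent.rank_matrix ?_
  rw [← Matrix.vecMul_injective_iff]
  exact (injective_iff_map_eq_zero M.vecMulLinear).2 h

theorem linearIndependent_row_of_rank [Fintype ι] [Fintype κ] (M : Matrix ι κ K) (h : M.rank = Fintype.card ι) :
    LinearIndependent K M.row := by
  rw [linearIndependent_iff_card_eq_finrank_span, ← h, rank_eq_finrank_span_row]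
  rfl

theorem eq_zero_of_vecMul_eq_zero [Fintype ι] {M : Matrix ι κ K} (h : LinearIndependent K M.row) {v : ι → K}
    (hv : v ᵥ* M = 0) : v = 0 := by
  rw [← Matrix.vecMul_injective_iff] at h
  exact h (by simpa using hv)

theorem rank_eq_card_of_mulVec_eq_zero [Fintype ι] [Fintype κ] (M : Matrix ι κ K)
    (h : ∀ v, M *ᵥ v = 0 → v = 0) : M.rank = Fintype.card κ := by
  rw [← rank_transpose]
  exact rank_eq_card_of_vecMul_eq_zero _ fun v hv => h v (by rwa [vecMul_transpose] at hv)

theorem eq_zero_of_mulVec_eq_zero [Fintype ι] [Fintype κ] (M : Matrix ι κ K)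
    (h : M.rank = Fintype.card κ) {v : κ → K} (hv : M *ᵥ v = 0) : v = 0 := by
  rw [← rank_transpose] at h
  exact eq_zero_of_vecMul_eq_zero (linearIndependent_row_of_rank _ h) (by rwa [vecMul_transpose])

theorem rank_mul_eq_left_of_mul_eq_one [Fintype κ] [Fintype l] [DecidableEq κ]
    (Y : Matrix ι κ K) {Z : Matrix κ l K}
    {W : Matrix l κ K} (hZ : Z * W = 1) : (Y * Z).rank = Y.rank := by
  refine le_antisymm (rank_mul_le_left _ _) ?_
  conv_lhs => rw [← Matrix.mul_one Y, ← hZ, ← Matrix.mul_assoc]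
  exact rank_mul_le_left _ _

theorem exists_eq_mul_of_row_mem_span [Fintype κ] (M : Matrix ι l K) (P : Matrix κ l K)
    (h : ∀ i, M i ∈ Submodule.span K (Set.range P.row)) : ∃ L : Matrix ι κ K, M = L * P := by
  have h' : ∀ i, ∃ c : κ → K, ∑ j, c j • P.row j = M i := fun i =>
    (Submodule.mem_span_range_iff_exists_fun K).1 (h i)
  choose c hc using h'
  refine ⟨Matrix.of c, ?_⟩
  ext i j
  rw [← hc i]
  simp [Matrix.mul_apply, Finset.sum_apply]

theorem span_row_fromRows (M : Matrix ι l K) (P : Matrix κ l K) :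
    Submodule.span K (Set.range (fromRows M P).row) =
      Submodule.span K (Set.range M.row) ⊔ Submodule.span K (Set.range P.row) := by
  have : Set.range (fromRows M P).row = Set.range M.row ∪ Set.range P.row := by
    rw [show (fromRows M P).row = Sum.elim M.row P.row by
      funext i; cases i <;> rfl]
    exact Set.Sum.elim_range _ _
  rw [this, Submodule.span_union]

theorem span_row_eq_of_rank_fromRows [Fintype ι] [Fintype κ] [Fintype l]
    (M : Matrix ι l K) (P : Matrix κ l K)
    (h : (fromRows M P).rank = P.rank) :
    Submodule.span K (Set.range (fromRows M P).row) = Submodule.span K (Set.range P.row) := by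
  rw [rank_eq_finrank_span_row, rank_eq_finrank_span_row] at h
  refine (Submodule.eq_of_le_of_finrank_eq ?_ h.symm).symm
  rw [span_row_fromRows]
  exact le_sup_right

theorem rank_fromRows_eq_of_row_mem_span [Fintype ι] [Fintype κ] [Fintype l]
    (M : Matrix ι l K) (P : Matrix κ l K)
    (h : ∀ i, M i ∈ Submodule.span K (Set.range P.row)) : (fromRows M P).rank = P.rank := by
  rw [rank_eq_finrank_span_row, rank_eq_finrank_span_row, span_row_fromRows, sup_eq_right.2]
  rw [Submodule.span_le]
  rintro _ ⟨i, rfl⟩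
  exact h i

end RankLemmas

/-! ### Powers of a matrix via Cayley–Hamilton -/

section CayleyHamilton

variable {K : Type*} [Field K] {n : ℕ}

theorem exists_pow_eq_sum (A : Matrix (Fin n) (Fin n) K) (k : ℕ) :
    ∃ c : Fin n → K, A ^ k = ∑ i, c i • A ^ (i : ℕ) := by
  -- For `n = 0` the characteristic polynomial is `1`, and the strict degree bound below fails.
  rcases Nat.eq_zero_or_pos n with rfl | hn
  · exact ⟨0, Subsingleton.elim _ _⟩
  have hdeg : (Polynomial.X ^ k %ₘ A.charpoly).natDegree < n := by
    have h := Polynomial.natDegree_modByMonic_lt (Polynomial.X ^ k) A.charpoly_monic (by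
      intro h1
      have := A.charpoly_natDegree_eq_dim
      rw [h1] at this
      simp at this
      omega)
    simpa using h
  refine ⟨fun i => (Polynomial.X ^ k %ₘ A.charpoly).coeff i, ?_⟩
  rw [Matrix.pow_eq_aeval_mod_charpoly, Polynomial.aeval_eq_sum_range' hdeg, Finset.sum_range]

theorem mulVec_pow_eq_zero {ι : Type*} (A : Matrix (Fin n) (Fin n) K) (C : Matrix ι (Fin n) K)
    (v : Fin n → K) (h : ∀ k < n, (C * A ^ k) *ᵥ v = 0) (k : ℕ) : (C * A ^ k) *ᵥ v = 0 := by
  obtain ⟨c, hc⟩ := exists_pow_eq_sum A k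
  rw [hc, Matrix.mul_sum, Matrix.sum_mulVec]
  refine Finset.sum_eq_zero fun i _ => ?_
  rw [Matrix.mul_smul, Matrix.smul_mulVec, h i i.2, smul_zero]

end CayleyHamilton

/-! ### The least invariant row space and functional observability -/

section Observability

variable {n p r : ℕ}

theorem obsMatrix_mulVec_eq_zero_iff (A : Matrix (Fin n) (Fin n) ℝ) (C : Matrix (Fin p) (Fin n) ℝ)
    (v : Fin n → ℝ) : obsMatrix A C *ᵥ v = 0 ↔ ∀ k, (C * A ^ k) *ᵥ v = 0 := by
  constructor
  · intro h
    refine mulVec_pow_eq_zero A C v fun k hk => ?_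
    funext i
    exact congrFun h (⟨k, hk⟩, i)
  · intro h
    funext ki
    exact congrFun (h ki.1) ki.2

theorem row_mul_pow_mem_span (A : Matrix (Fin n) (Fin n) ℝ) (F : Matrix (Fin r) (Fin n) ℝ)
    (k : ℕ) (i : Fin r) :
    (F * A ^ k) i ∈ Submodule.span ℝ (Set.range (obsMatrix A F).row) := by
  obtain ⟨c, hc⟩ := exists_pow_eq_sum A k
  have : (F * A ^ k) i = ∑ j, c j • (obsMatrix A F).row (j, i) := by
    rw [hc, Matrix.mul_sum]
    funext l
    simp [Matrix.sum_apply, obsMatrix, Matrix.row]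
  rw [this]
  exact Submodule.sum_mem _ fun j _ => Submodule.smul_mem _ _ (Submodule.subset_span ⟨_, rfl⟩)

theorem row_mem_span_obsMatrix (A : Matrix (Fin n) (Fin n) ℝ) (F : Matrix (Fin r) (Fin n) ℝ)
    (i : Fin r) : F i ∈ Submodule.span ℝ (Set.range (obsMatrix A F).row) := by
  simpa using row_mul_pow_mem_span A F 0 i

theorem vecMul_mem_span_obsMatrix (A : Matrix (Fin n) (Fin n) ℝ) (F : Matrix (Fin r) (Fin n) ℝ)
    {v : Fin n → ℝ} (hv : v ∈ Submodule.span ℝ (Set.range (obsMatrix A F).row)) :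
    v ᵥ* A ∈ Submodule.span ℝ (Set.range (obsMatrix A F).row) := by
  have : Submodule.span ℝ (Set.range (obsMatrix A F).row) ≤
      (Submodule.span ℝ (Set.range (obsMatrix A F).row)).comap A.vecMulLinear := by
    rw [Submodule.span_le]
    rintro _ ⟨ki, rfl⟩
    have h := row_mul_pow_mem_span A F (ki.1 + 1) ki.2
    rw [pow_succ, ← Matrix.mul_assoc] at h
    exact h
  exact this hv

/-- Minimality: with `vecMul_mem_span_obsMatrix` it identifies the row space as the least invariant
subspace containing the rows of `F`. -/
theorem obsMatrix_span_le (A : Matrix (Fin n) (Fin n) ℝ) (F : Matrix (Fin r) (Fin n) ℝ)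
    (V : Submodule ℝ (Fin n → ℝ)) (hF : ∀ i, F i ∈ V) (hA : ∀ v ∈ V, v ᵥ* A ∈ V) :
    Submodule.span ℝ (Set.range (obsMatrix A F).row) ≤ V := by
  rw [Submodule.span_le]
  rintro _ ⟨⟨k, i⟩, rfl⟩
  suffices h : ∀ j : ℕ, (F * A ^ j) i ∈ V from h k
  intro j
  induction j with
  | zero => simpa using hF i
  | succ j ih =>
    rw [pow_succ, ← Matrix.mul_assoc]
    exact hA _ ih

theorem intrinsicSubspace_eq_span (A : Matrix (Fin n) (Fin n) ℝ) (F : Matrix (Fin r) (Fin n) ℝ) :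
    intrinsicSubspace A F = Submodule.span ℝ (Set.range (obsMatrix A F).row) := by
  have : ctrbMatrix Aᵀ Fᵀ = (obsMatrix A F)ᵀ := by
    ext i kj
    simp [ctrbMatrix, obsMatrix, ← Matrix.transpose_pow, ← Matrix.transpose_mul]
  rw [intrinsicSubspace, this, Matrix.range_mulVecLin]
  rfl

/-- Equality of ranks forces the row space of `obsMatrix A F` into that of `obsMatrix A C`, whose
elements annihilate the unobservable vectors. -/
theorem mulVec_eq_zero_of_isFunctionallyObservable {A : Matrix (Fin n) (Fin n) ℝ}
    {C : Matrix (Fin p) (Fin n) ℝ} {F : Matrix (Fin r) (Fin n) ℝ}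
    (h : IsFunctionallyObservable A C F) {f v : Fin n → ℝ}
    (hf : f ∈ Submodule.span ℝ (Set.range (obsMatrix A F).row)) (hv : obsMatrix A C *ᵥ v = 0) :
    f ⬝ᵥ v = 0 := by
  have h' : (fromRows (obsMatrix A F) (obsMatrix A C)).rank = (obsMatrix A C).rank := by
    rw [← h, rank_eq_finrank_span_row, rank_eq_finrank_span_row, span_row_fromRows,
      span_row_fromRows, sup_comm]
  have hs := span_row_eq_of_rank_fromRows _ _ h'
  rw [span_row_fromRows] at hs
  have hf' : f ∈ Submodule.span ℝ (Set.range (obsMatrix A C).row) :=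
    hs ▸ Submodule.mem_sup_left hf
  obtain ⟨c, rfl⟩ := (Submodule.mem_span_range_iff_exists_fun ℝ).1 hf'
  rw [sum_dotProduct]
  refine Finset.sum_eq_zero fun i _ => ?_
  rw [smul_dotProduct, show (obsMatrix A C).row i ⬝ᵥ v = 0 from congrFun hv i, smul_zero]

end Observability

/-! ### A Lyapunov inequality from a Gramian -/

section Lyapunov

attribute [local instance] Matrix.linftyOpNormedRing Matrix.linftyOpNormedAlgebra

variable {ι κ : Type*} [Fintype ι] [DecidableEq ι] [Fintype κ]

theorem dotProduct_self_nonneg {ι : Type*} [Fintype ι] (v : ι → ℝ) : 0 ≤ v ⬝ᵥ v :=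
  Finset.sum_nonneg fun i _ => mul_self_nonneg (v i)

theorem intervalIntegral_linearMap_comp {E F : Type*} [NormedAddCommGroup E] [NormedSpace ℝ E]
    [FiniteDimensional ℝ E] [NormedAddCommGroup F] [NormedSpace ℝ F] [CompleteSpace F]
    (φ : E →ₗ[ℝ] F) {f : ℝ → E} (hf : Continuous f) (a b : ℝ) :
    ∫ t in a..b, φ (f t) = φ (∫ t in a..b, f t) := by
  have : CompleteSpace E := FiniteDimensional.complete ℝ E
  exact (LinearMap.toContinuousLinearMap φ).intervalIntegral_comp_comm (hf.intervalIntegrable a b)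

theorem hasDerivAt_exp_smul (G : Matrix ι ι ℝ) (t : ℝ) :
    HasDerivAt (fun t : ℝ => NormedSpace.exp (t • G)) (G * NormedSpace.exp (t • G)) t :=
  hasDerivAt_exp_smul_const' G t

theorem HasDerivAt.linearMap_comp {E F : Type*} [NormedAddCommGroup E] [NormedSpace ℝ E]
    [FiniteDimensional ℝ E] [NormedAddCommGroup F] [NormedSpace ℝ F]
    (φ : E →ₗ[ℝ] F) {f : ℝ → E} {f' : E} {t : ℝ} (hf : HasDerivAt f f' t) :
    HasDerivAt (fun t => φ (f t)) (φ f') t :=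
  (LinearMap.toContinuousLinearMap φ).hasFDerivAt.comp_hasDerivAt t hf

theorem HasDerivWithinAt.linearMap_comp {E F : Type*} [NormedAddCommGroup E] [NormedSpace ℝ E]
    [FiniteDimensional ℝ E] [NormedAddCommGroup F] [NormedSpace ℝ F]
    (φ : E →ₗ[ℝ] F) {f : ℝ → E} {f' : E} {s : Set ℝ} {t : ℝ} (hf : HasDerivWithinAt f f' s t) :
    HasDerivWithinAt (fun t => φ (f t)) (φ f') s t :=
  (LinearMap.toContinuousLinearMap φ).hasFDerivAt.comp_hasDerivWithinAt t hf

/-- Differentiate `k` times and evaluate at `t = 0`. Derivatives within `[0, 1]` are unique also at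
the endpoints, so the induction covers the closed interval. -/
theorem vecMul_pow_mul_eq_zero_of_exp (G : Matrix ι ι ℝ) (B : Matrix ι κ ℝ) (v : ι → ℝ)
    (h : ∀ t ∈ Set.Icc (0 : ℝ) 1, v ᵥ* (NormedSpace.exp (t • G) * B) = 0) (k : ℕ) :
    v ᵥ* (G ^ k * B) = 0 := by
  have key : ∀ k : ℕ, ∀ t ∈ Set.Icc (0 : ℝ) 1,
      v ᵥ* (G ^ k * NormedSpace.exp (t • G) * B) = 0 := by
    intro k
    induction k with
    | zero => simpa using h
    | succ k ih =>
      intro t ht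
      let φ : Matrix ι ι ℝ →ₗ[ℝ] (κ → ℝ) :=
        { toFun := fun X => v ᵥ* (G ^ k * X * B)
          map_add' := fun X Y => by rw [Matrix.mul_add, Matrix.add_mul, Matrix.vecMul_add]
          map_smul' := fun c X => by
            rw [Matrix.mul_smul, Matrix.smul_mul, Matrix.vecMul_smul, RingHom.id_apply] }
      have h1 := (HasDerivAt.linearMap_comp φ (hasDerivAt_exp_smul G t)).hasDerivWithinAt
        (s := Set.Icc (0 : ℝ) 1)
      have h2 : HasDerivWithinAt (fun t => φ (NormedSpace.exp (t • G))) 0 (Set.Icc (0 : ℝ) 1) t :=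
        (hasDerivWithinAt_const t _ (0 : κ → ℝ)).congr (fun s hs => ih s hs) (ih t ht)
      have h3 := (uniqueDiffOn_Icc (zero_lt_one' ℝ) t ht).eq_deriv _ h1 h2
      rw [pow_succ, Matrix.mul_assoc (G ^ k)]
      exact h3
  simpa using key k 0 (by simp)

/-- A Lyapunov inequality for a controllable pair, solved by a finite-horizon discounted Gramian. -/
theorem exists_lyapunov (A : Matrix ι ι ℝ) (B : Matrix ι κ ℝ)
    (hc : ∀ v, (∀ k, v ᵥ* (A ^ k * B) = 0) → v = 0) :
    ∃ W : Matrix ι ι ℝ, W.PosDef ∧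
      ∀ v, v ⬝ᵥ ((A * W + W * Aᵀ - B * Bᵀ) *ᵥ v) ≤ -2 * (v ⬝ᵥ (W *ᵥ v)) := by
  -- For `W = ∫ Φ` over `[0, 1]`, integrating `Φ' = G Φ + Φ Gᵀ` gives `G W + W Gᵀ = Φ 1 - B Bᵀ`,
  -- that is, `A W + W Aᵀ - B Bᵀ = -2 W - Φ 1`. The shift by `1` produces `-2 W`, and `Φ 1` is
  -- positive semidefinite.
  set G : Matrix ι ι ℝ := -(A + 1) with hG
  have hcG : ∀ v, (∀ k, v ᵥ* (G ^ k * B) = 0) → v = 0 := by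
    intro v hv
    refine hc v fun k => ?_
    -- Since `A = -G - 1`, the vectors annihilating every `G ^ j * B` are stable under `v ↦ v A`;
    -- generalizing over `v` lets the induction replace `v` by `v A`.
    suffices h : ∀ k : ℕ, ∀ v, (∀ j, v ᵥ* (G ^ j * B) = 0) → ∀ j, (v ᵥ* A ^ k) ᵥ* (G ^ j * B) = 0 by
      simpa [Matrix.vecMul_vecMul] using h k v hv 0
    intro k
    induction k with
    | zero => intro v hv; simpa using hv
    | succ k ih =>
      intro v hv j
      rw [pow_succ', ← Matrix.vecMul_vecMul v A]
      refine ih _ (fun j => ?_) j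
      have hA : A = -G - 1 := by rw [hG]; abel
      have h1 := hv (j + 1)
      rw [pow_succ', Matrix.mul_assoc, ← Matrix.vecMul_vecMul] at h1
      rw [hA, Matrix.vecMul_sub, Matrix.vecMul_neg, Matrix.vecMul_one, Matrix.sub_vecMul,
        Matrix.neg_vecMul, h1, hv j]
      simp
  let E : ℝ → Matrix ι ι ℝ := fun t => NormedSpace.exp (t • G)
  let Φ : ℝ → Matrix ι ι ℝ := fun t => E t * (B * Bᵀ) * (E t)ᵀ
  have hE : ∀ t, HasDerivAt E (G * E t) t := hasDerivAt_exp_smul G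
  have hET : ∀ t, HasDerivAt (fun t => (E t)ᵀ) ((E t)ᵀ * Gᵀ) t := fun t => by
    have := HasDerivAt.linearMap_comp (transposeLinearEquiv ι ι ℝ ℝ).toLinearMap (hE t)
    exact HasDerivAt.congr_deriv this (Matrix.transpose_mul _ _)
  let lin : Matrix ι ι ℝ →ₗ[ℝ] Matrix ι ι ℝ := LinearMap.mulLeft ℝ G + LinearMap.mulRight ℝ Gᵀ
  have hΦ : ∀ t, HasDerivAt Φ (lin (Φ t)) t := fun t => by
    have := ((hE t).mul_const (B * Bᵀ)).mul (hET t)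
    refine HasDerivAt.congr_deriv this ?_
    simp [lin, Φ, Matrix.mul_assoc]
  have hΦc : Continuous Φ := continuous_iff_continuousAt.2 fun t => (hΦ t).continuousAt
  have hlinc : Continuous fun t => lin (Φ t) :=
    (LinearMap.continuous_of_finiteDimensional lin).comp hΦc
  let W : Matrix ι ι ℝ := ∫ t in (0 : ℝ)..1, Φ t
  have hlin : lin W = Φ 1 - Φ 0 := by
    rw [← intervalIntegral_linearMap_comp lin hΦc]
    exact intervalIntegral.integral_eq_sub_of_hasDerivAt (fun t _ => hΦ t)
      (hlinc.intervalIntegrable _ _)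
  have hquad : ∀ t v, v ⬝ᵥ (Φ t *ᵥ v) = (v ᵥ* (E t * B)) ⬝ᵥ (v ᵥ* (E t * B)) := fun t v => by
    have : Φ t = (E t * B) * (E t * B)ᵀ := by
      simp [Φ, Matrix.transpose_mul, Matrix.mul_assoc]
    rw [this, ← Matrix.mulVec_mulVec, Matrix.mulVec_transpose, Matrix.dotProduct_mulVec]
  have hW : ∀ v, v ⬝ᵥ (W *ᵥ v) = ∫ t in (0 : ℝ)..1, v ⬝ᵥ (Φ t *ᵥ v) := fun v => by
    let φ : Matrix ι ι ℝ →ₗ[ℝ] ℝ :=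
      { toFun := fun X => v ⬝ᵥ (X *ᵥ v)
        map_add' := fun X Y => by rw [Matrix.add_mulVec, dotProduct_add]
        map_smul' := fun c X => by rw [Matrix.smul_mulVec, dotProduct_smul, RingHom.id_apply] }
    exact (intervalIntegral_linearMap_comp φ hΦc 0 1).symm
  refine ⟨W, ?_, fun v => ?_⟩
  · refine Matrix.PosDef.of_dotProduct_mulVec_pos ?_ fun v hv => ?_
    · have := intervalIntegral_linearMap_comp (transposeLinearEquiv ι ι ℝ ℝ).toLinearMap hΦc 0 1
      rw [Matrix.IsHermitian, Matrix.conjTranspose_eq_transpose_of_trivial]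
      refine this.symm.trans ?_
      refine intervalIntegral.integral_congr fun t _ => ?_
      simp [Φ, Matrix.transpose_mul, Matrix.mul_assoc]
    · rw [star_trivial, hW]
      obtain ⟨t, ht, hne⟩ : ∃ t ∈ Set.Icc (0 : ℝ) 1, v ᵥ* (E t * B) ≠ 0 := by
        by_contra! hcon
        exact hv (hcG v (vecMul_pow_mul_eq_zero_of_exp G B v hcon))
      have hcont : Continuous fun t => v ⬝ᵥ (Φ t *ᵥ v) := by fun_prop
      refine intervalIntegral.integral_pos zero_lt_one hcont.continuousOn (fun s _ => ?_)
        ⟨t, ht, ?_⟩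
      · rw [hquad]; exact dotProduct_self_nonneg _
      · rw [hquad]
        exact lt_of_le_of_ne (dotProduct_self_nonneg _) fun h => hne (dotProduct_self_eq_zero.1 h.symm)
  · have h0 : Φ 0 = B * Bᵀ := by simp [Φ, E]
    have h1 : 0 ≤ v ⬝ᵥ (Φ 1 *ᵥ v) := by rw [hquad]; exact dotProduct_self_nonneg _
    have h2 : A * W + W * Aᵀ - B * Bᵀ = -(2 : ℝ) • W - Φ 1 := by
      have h3 : lin W = -(A * W + W * Aᵀ) - (2 : ℝ) • W := by
        simp only [lin, hG, LinearMap.add_apply, LinearMap.mulLeft_apply, LinearMap.mulRight_apply,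
          Matrix.transpose_neg, Matrix.transpose_add, Matrix.transpose_one, Matrix.neg_mul,
          Matrix.mul_neg, Matrix.add_mul, Matrix.mul_add, Matrix.one_mul, Matrix.mul_one, two_smul]
        abel
      rw [h3, h0] at hlin
      have : A * W + W * Aᵀ = B * Bᵀ - (2 : ℝ) • W - Φ 1 := by
        calc A * W + W * Aᵀ = -(-(A * W + W * Aᵀ) - (2 : ℝ) • W) - (2 : ℝ) • W := by abel
          _ = B * Bᵀ - (2 : ℝ) • W - Φ 1 := by rw [hlin]; abel
      rw [this, neg_smul]
      abel
    rw [h2, Matrix.sub_mulVec, Matrix.smul_mulVec, dotProduct_sub, dotProduct_smul, smul_eq_mul]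
    linarith

end Lyapunov

/-! ### Exponential decay and stabilizing gains -/

section Decay

variable {ι κ : Type*} [Fintype ι] [Fintype κ]

theorem hasDerivWithinAt_dotProduct {x y : ℝ → ι → ℝ} {x' y' : ι → ℝ} {s : Set ℝ} {t : ℝ}
    (hx : HasDerivWithinAt x x' s t) (hy : HasDerivWithinAt y y' s t) :
    HasDerivWithinAt (fun t => x t ⬝ᵥ y t) (x' ⬝ᵥ y t + x t ⬝ᵥ y') s t := by
  have h : ∀ i ∈ Finset.univ, HasDerivWithinAt (fun t => x t i * y t i)
      (x' i * y t i + x t i * y' i) s t := fun i _ =>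
    (hasDerivWithinAt_pi.1 hx i).mul (hasDerivWithinAt_pi.1 hy i)
  have := HasDerivWithinAt.fun_sum h
  rwa [Finset.sum_add_distrib] at this

theorem HasDerivWithinAt.const_mulVec {l : Type*} [Fintype l] (M : Matrix l ι ℝ) {x : ℝ → ι → ℝ}
    {x' : ι → ℝ} {s : Set ℝ} {t : ℝ} (hx : HasDerivWithinAt x x' s t) :
    HasDerivWithinAt (fun t => M *ᵥ x t) (M *ᵥ x') s t :=
  HasDerivWithinAt.linearMap_comp M.mulVecLin hx

theorem tendsto_const_mulVec {l : Type*} (M : Matrix l ι ℝ) {x : ℝ → ι → ℝ}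
    (hx : Tendsto x atTop (𝓝 0)) : Tendsto (fun t => M *ᵥ x t) atTop (𝓝 0) := by
  have h : Continuous fun v : ι → ℝ => M *ᵥ v := by fun_prop
  have := (h.tendsto 0).comp hx
  rwa [Matrix.mulVec_zero] at this

/-- Grönwall in its simplest form: `exp (2 t) V t` is nonincreasing. -/
theorem tendsto_zero_of_deriv_le {V V' : ℝ → ℝ} (h0 : ∀ t, 0 ≤ t → 0 ≤ V t)
    (hV : ∀ t, 0 ≤ t → HasDerivWithinAt V (V' t) (Set.Ici 0) t)
    (hle : ∀ t, 0 ≤ t → V' t ≤ -2 * V t) : Tendsto V atTop (𝓝 0) := by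
  have hd : ∀ t, 0 ≤ t → HasDerivWithinAt (fun t => Real.exp (2 * t) * V t)
      (Real.exp (2 * t) * (2 * V t + V' t)) (Set.Ici 0) t := fun t ht => by
    have h1 : HasDerivAt (fun t : ℝ => Real.exp (2 * t)) (Real.exp (2 * t) * 2) t := by
      simpa using ((hasDerivAt_id t).const_mul 2).exp
    exact (h1.hasDerivWithinAt.mul (hV t ht)).congr_deriv (by ring)
  have hanti : AntitoneOn (fun t => Real.exp (2 * t) * V t) (Set.Ici 0) := by
    refine antitoneOn_of_hasDerivWithinAt_nonpos (convex_Ici 0)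
      (fun t ht => (hd t ht).continuousWithinAt)
      (fun t ht => (hd t (interior_subset ht)).mono interior_subset) fun t ht => ?_
    have := hle t (interior_subset ht)
    exact mul_nonpos_of_nonneg_of_nonpos (Real.exp_pos _).le (by linarith)
  have hbound : ∀ t, 0 ≤ t → V t ≤ Real.exp (-(2 * t)) * V 0 := fun t ht => by
    have := hanti (Set.mem_Ici.2 le_rfl) (Set.mem_Ici.2 ht) ht
    simp only [mul_zero, Real.exp_zero, one_mul] at this
    rw [Real.exp_neg, ← div_eq_inv_mul, le_div_iff₀ (Real.exp_pos _), mul_comm]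
    exact this
  have hlim : Tendsto (fun t : ℝ => Real.exp (-(2 * t)) * V 0) atTop (𝓝 0) := by
    have h1 : Tendsto (fun t : ℝ => 2 * t) atTop atTop := tendsto_id.const_mul_atTop two_pos
    simpa using (Real.tendsto_exp_neg_atTop_nhds_zero.comp h1).mul_const (V 0)
  exact tendsto_of_tendsto_of_tendsto_of_le_of_le' tendsto_const_nhds hlim
    ((eventually_ge_atTop 0).mono h0) ((eventually_ge_atTop 0).mono hbound)

-- Factor `W = Dᵀ D` with `D` invertible: the quadratic form is the squared length of `D x`.
open scoped MatrixOrder in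
theorem tendsto_zero_of_posDef [DecidableEq ι] {W : Matrix ι ι ℝ} (hW : W.PosDef) {x : ℝ → ι → ℝ}
    (h : Tendsto (fun t => x t ⬝ᵥ (W *ᵥ x t)) atTop (𝓝 0)) : Tendsto x atTop (𝓝 0) := by
  obtain ⟨D, hD, hWD⟩ : ∃ D : Matrix ι ι ℝ, IsUnit D ∧ W = Dᵀ * D := by
    obtain ⟨D, hD⟩ := CStarAlgebra.nonneg_iff_eq_star_mul_self.mp hW.posSemidef.nonneg
    have hdet := (Matrix.isUnit_iff_isUnit_det W).1 hW.isUnit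
    rw [hD, Matrix.det_mul] at hdet
    refine ⟨D, (Matrix.isUnit_iff_isUnit_det D).2 (isUnit_of_mul_isUnit_right hdet), ?_⟩
    rw [hD, Matrix.star_eq_conjTranspose, Matrix.conjTranspose_eq_transpose_of_trivial]
  have h1 : ∀ t, x t ⬝ᵥ (W *ᵥ x t) = (D *ᵥ x t) ⬝ᵥ (D *ᵥ x t) := fun t => by
    rw [hWD, ← Matrix.mulVec_mulVec, Matrix.dotProduct_mulVec, Matrix.vecMul_transpose]
  simp only [h1] at h
  have h2 : Tendsto (fun t => D *ᵥ x t) atTop (𝓝 0) := by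
    rw [tendsto_pi_nhds]
    intro i
    have h3 : Tendsto (fun t => (D *ᵥ x t) i ^ 2) atTop (𝓝 0) :=
      squeeze_zero (fun t => sq_nonneg _) (fun t => by
        rw [sq]
        exact Finset.single_le_sum (f := fun j => (D *ᵥ x t) j * (D *ᵥ x t) j)
          (fun j _ => mul_self_nonneg _) (Finset.mem_univ i)) h
    have h4 := h3.sqrt
    simp only [Real.sqrt_sq_eq_abs, Real.sqrt_zero] at h4
    exact (tendsto_zero_iff_abs_tendsto_zero _).2 h4
  have h5 := tendsto_const_mulVec D⁻¹ h2
  simpa [Matrix.mulVec_mulVec, Matrix.nonsing_inv_mul D ((Matrix.isUnit_iff_isUnit_det D).1 hD)]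
    using h5

/-- An observable linear system can be stabilized by output injection. -/
theorem exists_stabilizing_injection [DecidableEq ι] {p : Type*} [Fintype p]
    (A : Matrix ι ι ℝ) (C : Matrix p ι ℝ)
    (ho : ∀ v, (∀ k, (C * A ^ k) *ᵥ v = 0) → v = 0) :
    ∃ L : Matrix ι p ℝ, ∀ e : ℝ → ι → ℝ,
      (∀ t, 0 ≤ t → HasDerivWithinAt e ((A - L * C) *ᵥ e t) (Set.Ici 0) t) →
      Tendsto e atTop (𝓝 0) := by
  obtain ⟨W, hW, hle⟩ := exists_lyapunov Aᵀ Cᵀ fun v hv => ho v fun k => by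
    simpa [← Matrix.transpose_pow, ← Matrix.transpose_mul, Matrix.vecMul_transpose] using hv k
  have hdet := (Matrix.isUnit_iff_isUnit_det W).1 hW.isUnit
  have hWT : Wᵀ = W :=
    (Matrix.conjTranspose_eq_transpose_of_trivial W).symm.trans hW.isHermitian
  -- The derivative of `eᵀ W e` counts the injection term twice, so the factor `1 / 2` leaves
  -- exactly `-Cᵀ C`.
  refine ⟨(1 / 2 : ℝ) • (W⁻¹ * Cᵀ), fun e he => tendsto_zero_of_posDef hW ?_⟩
  refine tendsto_zero_of_deriv_le (fun t _ => by simpa using hW.posSemidef.dotProduct_mulVec_nonneg (e t))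
    (fun t ht => hasDerivWithinAt_dotProduct (he t ht) (HasDerivWithinAt.const_mulVec W (he t ht)))
    fun t ht => ?_
  refine le_trans (le_of_eq ?_) (hle (e t))
  set M := A - (1 / 2 : ℝ) • (W⁻¹ * Cᵀ) * C with hM
  have h1 : (M *ᵥ e t) ⬝ᵥ (W *ᵥ e t) = e t ⬝ᵥ ((Mᵀ * W) *ᵥ e t) := by
    rw [← Matrix.mulVec_mulVec, Matrix.dotProduct_mulVec (e t), Matrix.vecMul_transpose]
  rw [h1, Matrix.mulVec_mulVec, ← dotProduct_add, ← Matrix.add_mulVec]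
  congr 2
  have hW1 : W * M = W * A - (1 / 2 : ℝ) • (Cᵀ * C) := by
    rw [hM, Matrix.mul_sub, Matrix.smul_mul, Matrix.mul_smul, Matrix.mul_assoc W⁻¹,
      Matrix.mul_nonsing_inv_cancel_left _ _ hdet]
  have hW2 : Mᵀ * W = Aᵀ * W - (1 / 2 : ℝ) • (Cᵀ * C) := by
    have := congrArg Matrix.transpose hW1
    simpa [Matrix.transpose_mul, hWT] using this
  rw [hW1, hW2, Matrix.transpose_transpose, Matrix.transpose_transpose]
  module

/-- A controllable linear system can be stabilized by state feedback. -/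
theorem exists_stabilizing_feedback [DecidableEq ι] (A : Matrix ι ι ℝ) (B : Matrix ι κ ℝ)
    (hc : ∀ v, (∀ k, v ᵥ* (A ^ k * B) = 0) → v = 0) :
    ∃ K : Matrix κ ι ℝ, ∀ x : ℝ → ι → ℝ,
      (∀ t, 0 ≤ t → HasDerivWithinAt x ((A - B * K) *ᵥ x t) (Set.Ici 0) t) →
      Tendsto x atTop (𝓝 0) := by
  obtain ⟨W, hW, hle⟩ := exists_lyapunov A B hc
  have hdet := (Matrix.isUnit_iff_isUnit_det W).1 hW.isUnit
  have hWT : Wᵀ = W :=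
    (Matrix.conjTranspose_eq_transpose_of_trivial W).symm.trans hW.isHermitian
  refine ⟨(1 / 2 : ℝ) • (Bᵀ * W⁻¹), fun x hx => ?_⟩
  set M := A - B * (1 / 2 : ℝ) • (Bᵀ * W⁻¹) with hM
  -- The Lyapunov function is `xᵀ W⁻¹ x`; in the variable `y = W⁻¹ x` it is `yᵀ W y`, to which the
  -- inequality for `W` applies.
  let y : ℝ → ι → ℝ := fun t => W⁻¹ *ᵥ x t
  have hxy : ∀ t, x t = W *ᵥ y t := fun t => by
    simp [y, Matrix.mulVec_mulVec, Matrix.mul_nonsing_inv _ hdet]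
  have hMW : M * W = A * W - (1 / 2 : ℝ) • (B * Bᵀ) := by
    rw [hM, Matrix.sub_mul, Matrix.mul_smul, Matrix.smul_mul, Matrix.mul_assoc B, Matrix.mul_assoc Bᵀ,
      Matrix.nonsing_inv_mul _ hdet, Matrix.mul_one]
  have hWM : W * Mᵀ = W * Aᵀ - (1 / 2 : ℝ) • (B * Bᵀ) := by
    have := congrArg Matrix.transpose hMW
    simpa [Matrix.transpose_mul, hWT] using this
  have hy : ∀ t, 0 ≤ t → HasDerivWithinAt y (W⁻¹ *ᵥ (M *ᵥ x t)) (Set.Ici 0) t := fun t ht =>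
    HasDerivWithinAt.const_mulVec _ (hx t ht)
  have hlim : Tendsto y atTop (𝓝 0) := by
    refine tendsto_zero_of_posDef hW ?_
    refine tendsto_zero_of_deriv_le
      (fun t _ => by simpa using hW.posSemidef.dotProduct_mulVec_nonneg (y t))
      (fun t ht => hasDerivWithinAt_dotProduct (hy t ht)
        (HasDerivWithinAt.const_mulVec W (hy t ht)))
      fun t ht => ?_
    refine le_trans (le_of_eq ?_) (hle (y t))
    have h1 : W *ᵥ (W⁻¹ *ᵥ (M *ᵥ x t)) = (M * W) *ᵥ y t := by
      rw [Matrix.mulVec_mulVec, Matrix.mul_nonsing_inv _ hdet, Matrix.one_mulVec, hxy,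
        Matrix.mulVec_mulVec]
    have h2 : (W⁻¹ *ᵥ (M *ᵥ x t)) ⬝ᵥ (W *ᵥ y t) = y t ⬝ᵥ ((W * Mᵀ) *ᵥ y t) := by
      rw [dotProduct_comm, ← Matrix.vecMul_transpose, hWT, ← Matrix.dotProduct_mulVec, h1,
        Matrix.dotProduct_mulVec, dotProduct_comm, ← Matrix.mulVec_transpose, Matrix.transpose_mul, hWT]
    rw [h1, h2, ← dotProduct_add, ← Matrix.add_mulVec, hMW, hWM]
    congr 2
    module
  have := tendsto_const_mulVec W hlim
  simpa [← hxy] using this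

end Decay

/-! ### Stable linear systems under vanishing perturbations -/

section Perturbation

attribute [local instance] Matrix.linftyOpNormedRing Matrix.linftyOpNormedAlgebra

theorem exists_linear_solution {E : Type*} [NormedAddCommGroup E] [NormedSpace ℝ E]
    [FiniteDimensional ℝ E] (φ : E →ₗ[ℝ] E) (x₀ : E) :
    ∃ x : ℝ → E, x 0 = x₀ ∧ ∀ t, HasDerivAt x (φ (x t)) t := by
  have : CompleteSpace E := FiniteDimensional.complete ℝ E
  let Φ : E →L[ℝ] E := LinearMap.toContinuousLinearMap φ
  refine ⟨fun t => NormedSpace.exp (t • Φ) x₀, by simp, fun t => ?_⟩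
  have h := hasDerivAt_exp_smul_const' Φ t
  exact (h.clm_apply (hasDerivAt_const t x₀)).congr_deriv (by simp [Φ])

/-- Compactness bounds `f` by some `S` on one window of length `T`. Each later window halves that
contribution, while the errors `ε / 4` accumulate to at most `ε / 2`, the fixed point of `a ↦ a / 2
+ ε / 4`. -/
theorem tendsto_zero_of_contraction {f : ℝ → ℝ} {T : ℝ} (hT : 0 < T)
    (hc : ContinuousOn f (Set.Ici 0)) (h0 : ∀ t, 0 ≤ f t)
    (h : ∀ ε > 0, ∃ t₀, 0 ≤ t₀ ∧ ∀ t, t₀ ≤ t → f (t + T) ≤ f t / 2 + ε) :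
    Tendsto f atTop (𝓝 0) := by
  rw [Metric.tendsto_atTop]
  intro ε hε
  obtain ⟨t₀, ht₀, hf⟩ := h (ε / 4) (by linarith)
  obtain ⟨S, hS⟩ := (isCompact_Icc (a := t₀) (b := t₀ + T)).exists_bound_of_continuousOn
    (hc.mono fun t ht => ht₀.trans ht.1)
  have hS0 : 0 ≤ S := (norm_nonneg _).trans (hS t₀ ⟨le_rfl, by linarith⟩)
  have key : ∀ k : ℕ, ∀ t, t₀ + k * T ≤ t → t ≤ t₀ + (k + 1) * T → f t ≤ ε / 2 + S / 2 ^ k := by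
    intro k
    induction k with
    | zero =>
      intro t h1 h2
      have := (le_abs_self _).trans (hS t ⟨by simpa using h1, by simpa using h2⟩)
      simp only [pow_zero, div_one]
      linarith
    | succ k ih =>
      intro t h1 h2
      push_cast at h1 h2
      have h3 := ih (t - T) (by linarith) (by linarith)
      have h4 := hf (t - T) (by nlinarith [mul_nonneg (Nat.cast_nonneg (α := ℝ) k) hT.le])
      rw [sub_add_cancel] at h4
      rw [pow_succ, ← div_div]
      linarith
  obtain ⟨k₀, hk₀⟩ : ∃ k₀ : ℕ, S / 2 ^ k₀ < ε / 2 := by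
    have h1 : Tendsto (fun k : ℕ => S * (1 / 2 : ℝ) ^ k) atTop (𝓝 (S * 0)) :=
      (tendsto_pow_atTop_nhds_zero_of_lt_one (by norm_num) (by norm_num)).const_mul S
    rw [mul_zero] at h1
    obtain ⟨k, hk⟩ := (h1.eventually (gt_mem_nhds (half_pos hε))).exists
    exact ⟨k, by simpa [div_eq_mul_inv] using hk⟩
  refine ⟨t₀ + k₀ * T, fun t ht => ?_⟩
  rw [Real.dist_eq, sub_zero, abs_of_nonneg (h0 t)]
  have hdiv : (k₀ : ℝ) ≤ (t - t₀) / T := by rw [le_div_iff₀ hT]; linarith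
  have hpos : 0 ≤ (t - t₀) / T := (Nat.cast_nonneg _).trans hdiv
  have h1 := Nat.floor_le hpos
  have h2 := Nat.lt_floor_add_one ((t - t₀) / T)
  rw [le_div_iff₀ hT] at h1
  rw [div_lt_iff₀ hT] at h2
  have h3 := key ⌊(t - t₀) / T⌋₊ t (by linarith) (by linarith)
  have h4 : S / 2 ^ ⌊(t - t₀) / T⌋₊ ≤ S / 2 ^ k₀ :=
    div_le_div_of_nonneg_left hS0 (by positivity)
      (pow_le_pow_right₀ one_le_two (Nat.le_floor hdiv))
  linarith

variable {ι : Type*} [Fintype ι] [DecidableEq ι]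

/-- Variation of constants as an estimate: in the derivative of `exp ((t + T - τ) N) ζ(τ)` the terms
in `N` cancel, leaving only `b`. The constant depends on `N` and `T` alone. For `b = 0`, `δ = 0` it
yields uniqueness of solutions. -/
theorem exists_norm_sub_exp_mulVec_le (N : Matrix ι ι ℝ) (T : ℝ) (hT : 0 ≤ T) :
    ∃ c : ℝ, 0 ≤ c ∧ ∀ ζ b : ℝ → ι → ℝ,
      (∀ t, 0 ≤ t → HasDerivWithinAt ζ (N *ᵥ ζ t + b t) (Set.Ici 0) t) →
      ∀ t, 0 ≤ t → ∀ δ, (∀ τ ∈ Set.Icc t (t + T), ‖b τ‖ ≤ δ) →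
        ‖ζ (t + T) - NormedSpace.exp (T • N) *ᵥ ζ t‖ ≤ c * δ := by
  have hE : ∀ s, HasDerivAt (fun s : ℝ => NormedSpace.exp (s • N)) (NormedSpace.exp (s • N) * N) s :=
    hasDerivAt_exp_smul_const N
  have hEc : Continuous fun s : ℝ => NormedSpace.exp (s • N) :=
    continuous_iff_continuousAt.2 fun s => (hE s).continuousAt
  obtain ⟨c, hc⟩ := (isCompact_Icc (a := (0 : ℝ)) (b := T)).exists_bound_of_continuousOn
    hEc.continuousOn
  have hc0 : 0 ≤ c := (norm_nonneg _).trans (hc 0 ⟨le_rfl, hT⟩)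
  refine ⟨c * T, mul_nonneg hc0 hT, fun ζ b hζ t ht δ hδ => ?_⟩
  let g : ℝ → ι → ℝ := fun τ => NormedSpace.exp ((t + T - τ) • N) *ᵥ ζ τ
  have hg : ∀ τ ∈ Set.Icc t (t + T), HasDerivWithinAt g
      (NormedSpace.exp ((t + T - τ) • N) *ᵥ b τ) (Set.Icc t (t + T)) τ := fun τ hτ => by
    have h1 : HasDerivAt (fun τ => NormedSpace.exp ((t + T - τ) • N))
        (-(NormedSpace.exp ((t + T - τ) • N) * N)) τ := by
      have := (hE (t + T - τ)).scomp τ ((hasDerivAt_id τ).const_sub (t + T))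
      exact HasDerivAt.congr_deriv this (by simp)
    have h2 : HasDerivWithinAt ζ (N *ᵥ ζ τ + b τ) (Set.Icc t (t + T)) τ :=
      (hζ τ (ht.trans hτ.1)).mono fun s hs => ht.trans hs.1
    refine hasDerivWithinAt_pi.2 fun i => ?_
    let φ : Matrix ι ι ℝ →ₗ[ℝ] (ι → ℝ) :=
      { toFun := fun X => X i, map_add' := fun _ _ => rfl, map_smul' := fun _ _ => rfl }
    have h3 := hasDerivWithinAt_dotProduct
      (HasDerivAt.linearMap_comp φ h1).hasDerivWithinAt h2
    refine h3.congr_deriv ?_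
    change ((-(NormedSpace.exp ((t + T - τ) • N) * N)) *ᵥ ζ τ) i +
      (NormedSpace.exp ((t + T - τ) • N) *ᵥ (N *ᵥ ζ τ + b τ)) i = _
    rw [Matrix.mulVec_add, Matrix.neg_mulVec, Matrix.mulVec_mulVec]
    simp
  have hbound := norm_image_sub_le_of_norm_deriv_le_segment' (C := c * δ) hg (fun τ hτ =>
    (Matrix.linfty_opNorm_mulVec _ _).trans <| mul_le_mul
      (hc _ ⟨by linarith [hτ.2], by linarith [hτ.1]⟩) (hδ τ ⟨hτ.1, hτ.2.le⟩) (norm_nonneg _) hc0)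
    (t + T) ⟨by linarith, le_rfl⟩
  simp only [g, sub_self, zero_smul, NormedSpace.exp_zero, Matrix.one_mulVec,
    add_sub_cancel_left] at hbound
  calc _ ≤ _ := hbound
    _ = _ := by ring

/-- A stable linear system driven by a vanishing perturbation converges to zero. -/
theorem tendsto_zero_of_vanishing_perturbation (N : Matrix ι ι ℝ)
    (hN : ∀ ζ : ℝ → ι → ℝ, (∀ t, 0 ≤ t → HasDerivWithinAt ζ (N *ᵥ ζ t) (Set.Ici 0) t) →
      Tendsto ζ atTop (𝓝 0))
    {ζ b : ℝ → ι → ℝ} (hζ : ∀ t, 0 ≤ t → HasDerivWithinAt ζ (N *ᵥ ζ t + b t) (Set.Ici 0) t)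
    (hb : Tendsto b atTop (𝓝 0)) : Tendsto ζ atTop (𝓝 0) := by
  -- The columns of `exp (t N)` are themselves solutions, so `hN` makes them vanish in the limit.
  have hexp : Tendsto (fun t : ℝ => NormedSpace.exp (t • N)) atTop (𝓝 0) := by
    have hcol : ∀ v : ι → ℝ, Tendsto (fun t : ℝ => NormedSpace.exp (t • N) *ᵥ v) atTop (𝓝 0) :=
      fun v => hN _ fun t _ => by
        let φ : Matrix ι ι ℝ →ₗ[ℝ] (ι → ℝ) :=
          { toFun := fun X => X *ᵥ v
            map_add' := fun X Y => Matrix.add_mulVec X Y v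
            map_smul' := fun a X => Matrix.smul_mulVec a X v }
        have := HasDerivAt.linearMap_comp φ (hasDerivAt_exp_smul N t)
        rw [Matrix.mulVec_mulVec]
        exact this.hasDerivWithinAt
    refine tendsto_pi_nhds.2 fun i => tendsto_pi_nhds.2 fun j => ?_
    have := tendsto_pi_nhds.1 (hcol (Pi.single j 1)) i
    simpa [Matrix.mulVec_single_one] using this
  obtain ⟨T, hT, hT0⟩ : ∃ T : ℝ, ‖NormedSpace.exp (T • N)‖ < 1 / 2 ∧ 0 < T := by
    have h1 : Tendsto (fun t : ℝ => ‖NormedSpace.exp (t • N)‖) atTop (𝓝 0) := by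
      simpa using hexp.norm
    exact ((h1.eventually (gt_mem_nhds one_half_pos)).and (eventually_gt_atTop 0)).exists
  obtain ⟨c, hc0, hc⟩ := exists_norm_sub_exp_mulVec_le N T hT0.le
  rw [tendsto_zero_iff_norm_tendsto_zero]
  refine tendsto_zero_of_contraction hT0
    (fun t ht => (hζ t ht).continuousWithinAt.norm) (fun t => norm_nonneg _) fun ε hε => ?_
  -- Dividing by `c + 1` instead of `c` allows `c = 0`.
  have hδ : 0 < ε / (c + 1) := by positivity
  obtain ⟨t₁, ht₁⟩ := Metric.tendsto_atTop.1 hb _ hδ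
  refine ⟨max t₁ 0, le_max_right _ _, fun t ht => ?_⟩
  have h1 := hc ζ b hζ t ((le_max_right _ _).trans ht) (ε / (c + 1)) fun τ hτ => by
    have := ht₁ τ (((le_max_left _ _).trans ht).trans hτ.1)
    rw [dist_zero_right] at this
    exact this.le
  have h2 : ‖NormedSpace.exp (T • N) *ᵥ ζ t‖ ≤ 1 / 2 * ‖ζ t‖ :=
    (Matrix.linfty_opNorm_mulVec _ _).trans (mul_le_mul_of_nonneg_right hT.le (norm_nonneg _))
  have h3 : c * (ε / (c + 1)) ≤ ε := by
    rw [mul_div_assoc', div_le_iff₀ (by positivity)]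
    nlinarith
  have h4 := norm_sub_norm_le (ζ (t + T)) (NormedSpace.exp (T • N) *ᵥ ζ t)
  linarith

end Perturbation

/-! ### Complex vectors and the Hautus and Kalman tests -/

section Complexification

variable {ι κ : Type*} [Fintype ι]

theorem eq_zero_of_vecMul_map_ofReal (M : Matrix ι κ ℝ) (hM : ∀ v, v ᵥ* M = 0 → v = 0)
    {v : ι → ℂ} (hv : v ᵥ* M.map Complex.ofReal = 0) : v = 0 := by
  have hre : (fun i => (v i).re) = 0 := hM _ <| by
    funext j
    have := congrArg Complex.re (congrFun hv j)
    simpa [Matrix.vecMul, dotProduct] using this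
  have him : (fun i => (v i).im) = 0 := hM _ <| by
    funext j
    have := congrArg Complex.im (congrFun hv j)
    simpa [Matrix.vecMul, dotProduct] using this
  funext i
  exact Complex.ext (congrFun hre i) (congrFun him i)

theorem eq_zero_of_forall_mulVec_map_ofReal {α : Type*} (M : α → Matrix κ ι ℝ)
    (hM : ∀ v, (∀ a, M a *ᵥ v = 0) → v = 0)
    {v : ι → ℂ} (hv : ∀ a, (M a).map Complex.ofReal *ᵥ v = 0) : v = 0 := by
  have hre : (fun i => (v i).re) = 0 := hM _ fun a => by
    funext j
    have := congrArg Complex.re (congrFun (hv a) j)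
    simpa [Matrix.mulVec, dotProduct] using this
  have him : (fun i => (v i).im) = 0 := hM _ fun a => by
    funext j
    have := congrArg Complex.im (congrFun (hv a) j)
    simpa [Matrix.mulVec, dotProduct] using this
  funext i
  exact Complex.ext (congrFun hre i) (congrFun him i)

theorem map_ofReal_mul {l m o : Type*} [Fintype m] (M : Matrix l m ℝ) (N : Matrix m o ℝ) :
    (M * N).map Complex.ofReal = M.map Complex.ofReal * N.map Complex.ofReal :=
  Matrix.map_mul (f := Complex.ofRealHom)

variable [DecidableEq ι]

theorem map_ofReal_pow (M : Matrix ι ι ℝ) (k : ℕ) :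
    (M ^ k).map Complex.ofReal = M.map Complex.ofReal ^ k :=
  Matrix.map_pow M Complex.ofRealHom k

/-- The Hautus test implies the Kalman test. -/
theorem eq_zero_of_hautus (M : Matrix ι ι ℝ) (G : Matrix ι κ ℝ)
    (h : ∀ (s : ℂ) (v : ι → ℂ), v ᵥ* M.map Complex.ofReal = s • v →
      v ᵥ* G.map Complex.ofReal = 0 → v = 0)
    (v : ι → ℝ) (hv : ∀ k, v ᵥ* (M ^ k * G) = 0) : v = 0 := by
  set Mc := M.map Complex.ofReal
  set Gc := G.map Complex.ofReal
  -- `U` is invariant under `v ↦ v M`. Were it nonzero, it would contain a complex eigenvector,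
  -- which the Hautus hypothesis excludes.
  let U : Submodule ℂ (ι → ℂ) := ⨅ k : ℕ, LinearMap.ker (Mc ^ k * Gc).vecMulLinear
  have memU : ∀ w, w ∈ U ↔ ∀ k : ℕ, w ᵥ* (Mc ^ k * Gc) = 0 := fun w => by simp [U]
  have hinv : ∀ w ∈ U, Mc.vecMulLinear w ∈ U := fun w hw => by
    rw [memU] at hw ⊢
    intro k
    have := hw (k + 1)
    rwa [pow_succ', Matrix.mul_assoc, ← Matrix.vecMul_vecMul w Mc] at this
  have hU : U = ⊥ := by
    by_contra hne
    have : Nontrivial U := Submodule.nontrivial_iff_ne_bot.2 hne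
    obtain ⟨s, hs⟩ := Module.End.exists_eigenvalue (Mc.vecMulLinear.restrict hinv)
    obtain ⟨w, hw⟩ := hs.exists_hasEigenvector
    refine hw.2 (Subtype.ext (h s w ?_ ?_))
    · exact congrArg Subtype.val hw.apply_eq_smul
    · simpa using (memU w).1 w.2 0
  have hvU : (fun i => (v i : ℂ)) ∈ U := by
    rw [memU]
    intro k
    rw [← map_ofReal_pow, ← map_ofReal_mul]
    funext j
    have := congrArg Complex.ofReal (congrFun (hv k) j)
    simpa [Matrix.vecMul, dotProduct] using this
  rw [hU, Submodule.mem_bot] at hvU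
  funext i
  exact Complex.ofReal_injective (congrFun hvU i)

/-- The Kalman test implies the Hautus test. -/
theorem eq_zero_of_kalman (A : Matrix ι ι ℝ) (C : Matrix κ ι ℝ)
    (ho : ∀ v, (∀ k, (C * A ^ k) *ᵥ v = 0) → v = 0) {s : ℂ} {v : ι → ℂ}
    (hA : A.map Complex.ofReal *ᵥ v = s • v) (hC : C.map Complex.ofReal *ᵥ v = 0) : v = 0 := by
  refine eq_zero_of_forall_mulVec_map_ofReal (fun k => C * A ^ k) ho fun k => ?_
  have hk : ∀ k : ℕ, A.map Complex.ofReal ^ k *ᵥ v = s ^ k • v := by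
    intro k
    induction k with
    | zero => simp
    | succ k ih => rw [pow_succ, ← Matrix.mulVec_mulVec, hA, Matrix.mulVec_smul, ih, smul_smul, pow_succ']
  rw [map_ofReal_mul, map_ofReal_pow, ← Matrix.mulVec_mulVec, hk, Matrix.mulVec_smul, hC, smul_zero]

end Complexification

/-! ### Controller conditions, feedback gain and closed loop -/

section Controller

variable {n m r : ℕ} {ι : Type} [Fintype ι]

theorem eq_zero_of_controllerRankConditions {A : Matrix (Fin n) (Fin n) ℝ}
    {B : Matrix (Fin n) (Fin m) ℝ} {Fb : Matrix ι (Fin n) ℝ} (hLI : LinearIndependent ℝ Fb.row)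
    (h : ControllerRankConditions A B Fb) {s : ℂ} {v : ι → ℂ}
    (h1 : v ᵥ* (s • Fb.map Complex.ofReal - (Fb * A).map Complex.ofReal) = 0)
    (h2 : v ᵥ* (Fb * B).map Complex.ofReal = 0) : v = 0 := by
  refine eq_zero_of_vecMul_eq_zero
    (linearIndependent_row_of_rank _ ((h.2 s).trans hLI.rank_matrix)) ?_
  rw [Matrix.vecMul_fromCols, h1, h2]
  funext i
  cases i <;> rfl

theorem exists_mul_eq_of_controllerRankConditions {A : Matrix (Fin n) (Fin n) ℝ}
    {B : Matrix (Fin n) (Fin m) ℝ} {Fb : Matrix ι (Fin n) ℝ}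
    (h : ControllerRankConditions A B Fb) : ∃ M : Matrix ι ι ℝ, Fb * A = M * Fb := by
  refine exists_eq_mul_of_row_mem_span _ _ fun i => ?_
  rw [← span_row_eq_of_rank_fromRows _ _ h.1]
  exact Submodule.subset_span ⟨Sum.inl i, rfl⟩

/-- The first condition is invariance of the row space. The pencil condition descends from the
larger space spanned by the given completion to the least invariant subspace. -/
theorem controllerRankConditions_of_span_eq {A : Matrix (Fin n) (Fin n) ℝ}
    {B : Matrix (Fin n) (Fin m) ℝ} {F : Matrix (Fin r) (Fin n) ℝ}
    (hIFC : IsIntrinsicallyFunctionallyControllable A B F) {Fb : Matrix ι (Fin n) ℝ}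
    (hFb : RowsFormBasis Fb (Submodule.span ℝ (Set.range (obsMatrix A F).row))) :
    ControllerRankConditions A B Fb := by
  obtain ⟨hLI, hspan⟩ := hFb
  refine ⟨rank_fromRows_eq_of_row_mem_span _ _ fun i => ?_, fun s => ?_⟩
  · rw [hspan]
    exact vecMul_mem_span_obsMatrix A F (hspan ▸ Submodule.subset_span ⟨i, rfl⟩)
  rw [hLI.rank_matrix]
  refine rank_eq_card_of_vecMul_eq_zero _ fun v hv => ?_
  rw [Matrix.vecMul_fromCols] at hv
  have hv1 := congrArg (fun w => w ∘ Sum.inl) hv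
  have hv2 := congrArg (fun w => w ∘ Sum.inr) hv
  simp only [Sum.elim_comp_inl, Sum.elim_comp_inr] at hv1 hv2
  obtain ⟨k, Rh, -, hrank, hctrl⟩ := hIFC
  set Fh := fromRows F Rh
  have hLIh : LinearIndependent ℝ Fh.row := linearIndependent_row_of_rank _ (by simpa using hrank)
  obtain ⟨M, hM⟩ := exists_mul_eq_of_controllerRankConditions hctrl
  have hle : Submodule.span ℝ (Set.range (obsMatrix A F).row) ≤
      Submodule.span ℝ (Set.range Fh.row) := by
    refine obsMatrix_span_le A F _ (fun i => Submodule.subset_span ⟨Sum.inl i, rfl⟩) fun w hw => ?_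
    obtain ⟨c, rfl⟩ := (Submodule.mem_span_range_iff_exists_fun ℝ).1 hw
    rw [Matrix.sum_vecMul]
    refine Submodule.sum_mem _ fun i _ => ?_
    rw [Matrix.smul_vecMul]
    refine Submodule.smul_mem _ _ ?_
    rw [← span_row_eq_of_rank_fromRows _ _ hctrl.1]
    exact Submodule.subset_span ⟨Sum.inl i, rfl⟩
  obtain ⟨L, hL⟩ := exists_eq_mul_of_row_mem_span Fb Fh fun i =>
    hle (hspan ▸ Submodule.subset_span ⟨i, rfl⟩)
  have hvL : v ᵥ* L.map Complex.ofReal = 0 := by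
    refine eq_zero_of_controllerRankConditions hLIh hctrl (s := s) ?_ ?_
    · rw [Matrix.vecMul_vecMul, Matrix.mul_sub, Matrix.mul_smul, ← map_ofReal_mul, ← map_ofReal_mul,
        ← Matrix.mul_assoc, ← hL]
      exact hv1
    · rw [Matrix.vecMul_vecMul, ← map_ofReal_mul, ← Matrix.mul_assoc, ← hL]
      exact hv2
  refine eq_zero_of_vecMul_map_ofReal Fb (fun w hw => eq_zero_of_vecMul_eq_zero hLI hw) ?_
  rw [hL, map_ofReal_mul, ← Matrix.vecMul_vecMul, hvL, Matrix.zero_vecMul]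

/-- Since `v (s Fb - Fb A) = (s v - v M) Fb`, the pencil condition implies the Hautus test for `(M,
Fb B)`, and a gain stabilizing this pair is the required one. -/
theorem exists_isFunctionalController {A : Matrix (Fin n) (Fin n) ℝ}
    {B : Matrix (Fin n) (Fin m) ℝ} {Fb : Matrix ι (Fin n) ℝ} (hLI : LinearIndependent ℝ Fb.row)
    (h : ControllerRankConditions A B Fb) :
    ∃ K : Matrix (Fin m) ι ℝ, IsFunctionalController A B Fb K := by
  classical
  obtain ⟨M, hM⟩ := exists_mul_eq_of_controllerRankConditions h
  obtain ⟨K, hK⟩ := exists_stabilizing_feedback M (Fb * B) <|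
    eq_zero_of_hautus M (Fb * B) fun s v h1 h2 =>
      eq_zero_of_controllerRankConditions hLI h (s := s) (by
        rw [hM, map_ofReal_mul, Matrix.vecMul_sub, Matrix.vecMul_smul, ← Matrix.vecMul_vecMul, h1,
          Matrix.smul_vecMul, sub_self]) h2
  refine ⟨K, fun x hx => hK _ fun t ht => ?_⟩
  refine (HasDerivWithinAt.const_mulVec Fb (hx t ht)).congr_deriv ?_
  rw [Matrix.mulVec_add, Matrix.mulVec_mulVec, hM, Matrix.mulVec_neg, Matrix.mulVec_neg,
    Matrix.sub_mulVec]
  simp only [Matrix.mulVec_mulVec, Matrix.mul_assoc, sub_eq_add_neg]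

/-- The separation property: a functional controller, combined with a functional observer,
drives the functional to zero. -/
theorem tendsto_zero_of_isClosedLoopSolution {p q : ℕ} {A : Matrix (Fin n) (Fin n) ℝ}
    {B : Matrix (Fin n) (Fin m) ℝ} {C : Matrix (Fin p) (Fin n) ℝ} {Fb : Matrix ι (Fin n) ℝ}
    {M : Matrix ι ι ℝ} (hM : Fb * A = M * Fb) (hLI : LinearIndependent ℝ Fb.row)
    {K : Matrix (Fin m) ι ℝ} (hK : IsFunctionalController A B Fb K)
    {O : LinearObserver q p m ι} (hO : IsFunctionalObserver A B C Fb O)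
    {x : ℝ → Fin n → ℝ} {w : ℝ → Fin q → ℝ} (hxw : IsClosedLoopSolution A B C K O x w) :
    Tendsto (fun t => Fb *ᵥ x t) atTop (𝓝 0) := by
  classical
  let e : ℝ → ι → ℝ := fun t => O.estimate (w t) (C *ᵥ x t) - Fb *ᵥ x t
  have hxc : ContinuousOn x (Set.Ici 0) := fun t ht => (hxw.1 t ht).continuousWithinAt
  have hwc : ContinuousOn w (Set.Ici 0) := fun t ht => (hxw.2 t ht).continuousWithinAt
  -- The observer's guarantee covers continuous inputs only, so the closed-loop input must be shown
  -- continuous.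
  have huc : ContinuousOn (fun t => -(K *ᵥ O.estimate (w t) (C *ᵥ x t))) (Set.Ici 0) := by
    have h : Continuous fun z : (Fin n → ℝ) × (Fin q → ℝ) =>
        -(K *ᵥ (O.D *ᵥ z.2 + O.E *ᵥ (C *ᵥ z.1))) := by fun_prop
    have h2 : ContinuousOn (fun t => (x t, w t)) (Set.Ici 0) := hxc.prodMk hwc
    have h3 := h.comp_continuousOn h2
    simpa only [Function.comp_def, LinearObserver.estimate] using h3
  have he : Tendsto e atTop (𝓝 0) := hO _ x w huc hxw.1 hxw.2
  set N := M - Fb * B * K with hN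
  have hb : Tendsto (fun t => (-(Fb * B * K)) *ᵥ e t) atTop (𝓝 0) := tendsto_const_mulVec _ he
  -- The gain is known to act only on trajectories of the full system. Surjectivity of `Fb` lifts `ζ
  -- 0` to an initial state, and uniqueness identifies `ζ` with `Fb y` on `[0, ∞)`.
  have hstab : ∀ ζ : ℝ → ι → ℝ, (∀ t, 0 ≤ t → HasDerivWithinAt ζ (N *ᵥ ζ t) (Set.Ici 0) t) →
      Tendsto ζ atTop (𝓝 0) := by
    intro ζ hζ
    have hsurj : LinearMap.range Fb.mulVecLin = ⊤ := by
      refine Submodule.eq_top_of_finrank_eq ?_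
      rw [Module.finrank_fintype_fun_eq_card]
      exact hLI.rank_matrix
    obtain ⟨x₀, hx₀⟩ := LinearMap.range_eq_top.1 hsurj (ζ 0)
    obtain ⟨y, hy0, hy⟩ := exists_linear_solution (A - B * K * Fb).mulVecLin x₀
    have hyt : IsTrajectory A B (fun t => -(K *ᵥ (Fb *ᵥ y t))) y := fun t _ => by
      refine (hy t).hasDerivWithinAt.congr_deriv ?_
      rw [Matrix.mulVecLin_apply, Matrix.sub_mulVec, Matrix.mulVec_neg, Matrix.mulVec_mulVec,
        Matrix.mulVec_mulVec, sub_eq_add_neg]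
    refine (hK y hyt).congr' ?_
    filter_upwards [eventually_ge_atTop 0] with t ht
    obtain ⟨c, -, hc⟩ := exists_norm_sub_exp_mulVec_le N t ht
    have hd : ∀ s, 0 ≤ s → HasDerivWithinAt (fun s => Fb *ᵥ y s - ζ s)
        (N *ᵥ (Fb *ᵥ y s - ζ s) + 0) (Set.Ici 0) s := fun s hs => by
      refine ((HasDerivWithinAt.const_mulVec Fb (hy s).hasDerivWithinAt).sub (hζ s hs)).congr_deriv ?_
      have : Fb * (A - B * K * Fb) = N * Fb := by
        rw [hN, Matrix.mul_sub, Matrix.sub_mul, hM]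
        simp only [Matrix.mul_assoc]
      rw [Matrix.mulVecLin_apply, Matrix.mulVec_mulVec, this, add_zero, Matrix.mulVec_sub,
        Matrix.mulVec_mulVec]
    have h0 := hc _ (fun _ => 0) hd 0 le_rfl 0 (by simp)
    have hinit : Fb *ᵥ y 0 - ζ 0 = 0 := by
      rw [hy0, ← hx₀]
      exact sub_self _
    rw [hinit, Matrix.mulVec_zero, sub_zero, mul_zero, zero_add, norm_le_zero_iff] at h0
    exact sub_eq_zero.1 h0
  have hdyn : ∀ t, 0 ≤ t → HasDerivWithinAt (fun t => Fb *ᵥ x t)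
      (N *ᵥ (Fb *ᵥ x t) + (-(Fb * B * K)) *ᵥ e t) (Set.Ici 0) t := by
    intro t ht
    refine (HasDerivWithinAt.const_mulVec Fb (hxw.1 t ht)).congr_deriv ?_
    have hest : O.estimate (w t) (C *ᵥ x t) = e t + Fb *ᵥ x t := (sub_add_cancel _ _).symm
    beta_reduce
    rw [hest, hN, Matrix.mulVec_add, Matrix.mulVec_mulVec, hM, Matrix.sub_mulVec, Matrix.mulVec_neg,
      Matrix.mulVec_neg, Matrix.mulVec_add, Matrix.mulVec_add, Matrix.mulVec_add, Matrix.neg_mulVec]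
    simp only [Matrix.mulVec_mulVec, Matrix.mul_assoc]
    abel
  exact tendsto_zero_of_vanishing_perturbation N hstab hdyn hb

theorem exists_isClosedLoopSolution {p q : ℕ} (A : Matrix (Fin n) (Fin n) ℝ)
    (B : Matrix (Fin n) (Fin m) ℝ) (C : Matrix (Fin p) (Fin n) ℝ) (K : Matrix (Fin m) ι ℝ)
    (O : LinearObserver q p m ι) (x₀ : Fin n → ℝ) (w₀ : Fin q → ℝ) :
    ∃ (x : ℝ → Fin n → ℝ) (w : ℝ → Fin q → ℝ),
      x 0 = x₀ ∧ w 0 = w₀ ∧ IsClosedLoopSolution A B C K O x w := by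
  let U : (Fin n → ℝ) × (Fin q → ℝ) →ₗ[ℝ] (Fin m → ℝ) :=
    -(K.mulVecLin ∘ₗ (O.D.mulVecLin ∘ₗ LinearMap.snd ℝ _ _ +
      O.E.mulVecLin ∘ₗ C.mulVecLin ∘ₗ LinearMap.fst ℝ _ _))
  let φ : (Fin n → ℝ) × (Fin q → ℝ) →ₗ[ℝ] (Fin n → ℝ) × (Fin q → ℝ) :=
    (A.mulVecLin ∘ₗ LinearMap.fst ℝ _ _ + B.mulVecLin ∘ₗ U).prod
      (O.N.mulVecLin ∘ₗ LinearMap.snd ℝ _ _ + O.J.mulVecLin ∘ₗ C.mulVecLin ∘ₗ LinearMap.fst ℝ _ _ +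
        O.H.mulVecLin ∘ₗ U)
  obtain ⟨z, hz0, hz⟩ := exists_linear_solution φ (x₀, w₀)
  refine ⟨fun t => (z t).1, fun t => (z t).2, congrArg Prod.fst hz0, congrArg Prod.snd hz0, fun t _ => ?_, fun t _ => ?_⟩
  · exact (HasDerivAt.linearMap_comp (LinearMap.fst ℝ _ _) (hz t)).hasDerivWithinAt
  · exact (HasDerivAt.linearMap_comp (LinearMap.snd ℝ _ _) (hz t)).hasDerivWithinAt

end Controller

/-! ### Basis completion by selected rows -/

section Completion

/-- The extension is made among indices in `ι ⊕ κ`, not among vectors, so that the added rows come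
with the selection `σ`. -/
theorem exists_rowsFormBasis_completion {n : ℕ} {ι κ : Type} [Finite κ] (M : Matrix ι (Fin n) ℝ)
    (P : Matrix κ (Fin n) ℝ) (hM : LinearIndependent ℝ M.row)
    (hMP : ∀ i, M i ∈ Submodule.span ℝ (Set.range P.row)) :
    ∃ (k : ℕ) (σ : Fin k → κ),
      RowsFormBasis (fromRows M (P.submatrix σ id)) (Submodule.span ℝ (Set.range P.row)) := by
  classical
  have := Fintype.ofFinite κ
  let v : ι ⊕ κ → Fin n → ℝ := Sum.elim M.row P.row
  have hs : LinearIndepOn ℝ v (Set.range Sum.inl) :=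
    (linearIndepOn_range_iff Sum.inl_injective v).2 hM
  obtain ⟨b, -, hsb, hspan, hb⟩ := exists_linearIndepOn_extension hs (Set.subset_univ _)
  let c : Set κ := Sum.inr ⁻¹' b
  let σ : Fin (Fintype.card c) → κ := fun i => ((Fintype.equivFin c).symm i : κ)
  have hσ : Function.Injective σ := fun i j h =>
    (Fintype.equivFin c).symm.injective (Subtype.ext h)
  have hσr : Set.range σ = c := by
    ext i
    constructor
    · rintro ⟨j, rfl⟩
      exact ((Fintype.equivFin c).symm j).2
    · intro hi
      exact ⟨Fintype.equivFin c ⟨i, hi⟩, by simp [σ]⟩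
  let f : ι ⊕ Fin (Fintype.card c) → ι ⊕ κ := Sum.map id σ
  have hf : Function.Injective f := Sum.map_injective.2 ⟨Function.injective_id, hσ⟩
  have hfr : Set.range f = b := by
    ext i
    rcases i with i | i
    · simp only [f, Set.mem_range, Sum.exists, Sum.map_inl, Sum.map_inr, reduceCtorEq, exists_false,
        or_false, id, Sum.inl.injEq, exists_eq, true_iff]
      exact hsb ⟨i, rfl⟩
    · have : i ∈ Set.range σ ↔ Sum.inr i ∈ b := by rw [hσr]; rfl
      simpa [f] using this
  have hrow : (fromRows M (P.submatrix σ id)).row = v ∘ f := by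
    funext i
    cases i <;> rfl
  refine ⟨_, σ, ?_, ?_⟩
  · rw [hrow]
    rw [← hfr] at hb
    exact (linearIndepOn_range_iff hf v).1 hb
  · rw [hrow, Set.range_comp, hfr]
    refine le_antisymm ?_ ?_
    · rw [Submodule.span_le]
      rintro _ ⟨i, -, rfl⟩
      rcases i with i | i
      · exact hMP i
      · exact Submodule.subset_span ⟨i, rfl⟩
    · rw [Submodule.span_le]
      rintro _ ⟨i, rfl⟩
      exact hspan ⟨Sum.inr i, trivial, rfl⟩

end Completion

/-! ### Kalman decomposition, observer conditions and Luenberger observer -/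

section Kalman

variable {n p r h l : ℕ} {A : Matrix (Fin n) (Fin n) ℝ} {C : Matrix (Fin p) (Fin n) ℝ}
  {T : Matrix (Fin n) (Fin h ⊕ Fin l) ℝ} {S : Matrix (Fin h ⊕ Fin l) (Fin n) ℝ}
  {Ao : Matrix (Fin h) (Fin h) ℝ} {A₂₁ : Matrix (Fin l) (Fin h) ℝ} {Au : Matrix (Fin l) (Fin l) ℝ}
  {Co : Matrix (Fin p) (Fin h) ℝ}

/-- The top rows of `S` are the projection onto the observable quotient, which intertwines `A` with
`Ao`. -/
theorem toRows₁_mul_of_state (hTS : T * S = 1) (hst : S * A * T = fromBlocks Ao 0 A₂₁ Au) :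
    S.toRows₁ * A = Ao * S.toRows₁ := by
  have h1 : S * A = fromBlocks Ao 0 A₂₁ Au * S := by
    rw [← hst, Matrix.mul_assoc, hTS, Matrix.mul_one]
  rw [← fromRows_toRows S, ← fromRows_fromCols_eq_fromBlocks, fromRows_mul, fromRows_mul, fromCols_mul_fromRows] at h1
  simpa using congrArg toRows₁ h1

theorem eq_mul_toRows₁_of_mul_eq {ι : Type} {M : Matrix ι (Fin n) ℝ} {Mo : Matrix ι (Fin h) ℝ}
    (hTS : T * S = 1) (hM : M * T = fromCols Mo 0) : M = Mo * S.toRows₁ := by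
  have h1 : M = (fromCols Mo 0 : Matrix ι (Fin h ⊕ Fin l) ℝ) * S := by rw [← hM, Matrix.mul_assoc, hTS, Matrix.mul_one]
  rw [← fromRows_toRows S, fromCols_mul_fromRows] at h1
  simpa using h1

theorem toRows₁_mul_toCols₁ (hST : S * T = 1) : S.toRows₁ * T.toCols₁ = 1 := by
  ext i j
  have := congrFun (congrFun hST (Sum.inl i)) (Sum.inl j)
  simpa [Matrix.mul_apply, Matrix.one_apply] using this

theorem mul_pow_eq_mul_pow_toRows₁ {Z : Matrix (Fin h) (Fin n) ℝ} (hZ : Z * A = Ao * Z)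
    (hC : C = Co * Z) (k : ℕ) : C * A ^ k = Co * Ao ^ k * Z := by
  induction k with
  | zero => simpa using hC
  | succ k ih => rw [pow_succ, ← Matrix.mul_assoc, ih, Matrix.mul_assoc, hZ, pow_succ]; simp only [Matrix.mul_assoc]

theorem eq_zero_of_observable (hobs : (obsMatrix Ao Co).rank = h) (v : Fin h → ℝ)
    (hv : ∀ k, (Co * Ao ^ k) *ᵥ v = 0) : v = 0 :=
  eq_zero_of_mulVec_eq_zero (obsMatrix Ao Co) (by simpa using hobs)
    ((obsMatrix_mulVec_eq_zero_iff Ao Co v).2 hv)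

-- Take a basis adapted to `W ⊕ U`, with `U` the unobservable subspace and `W` a complement.
-- Invariance of `U` and vanishing of `C` on `U` give the zero blocks. An unobservable vector of
-- `(Ao, Co)` lifts into `U ∩ W = 0`.
variable (A C) in
theorem exists_isKalmanObsDecomposition :
    ∃ (h l : ℕ) (T : Matrix (Fin n) (Fin h ⊕ Fin l) ℝ) (S : Matrix (Fin h ⊕ Fin l) (Fin n) ℝ)
      (Ao : Matrix (Fin h) (Fin h) ℝ) (A₂₁ : Matrix (Fin l) (Fin h) ℝ)
      (Au : Matrix (Fin l) (Fin l) ℝ) (Co : Matrix (Fin p) (Fin h) ℝ),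
      IsKalmanObsDecomposition A C T S Ao A₂₁ Au Co := by
  let U : Submodule ℝ (Fin n → ℝ) := LinearMap.ker (obsMatrix A C).mulVecLin
  have memU : ∀ v, v ∈ U ↔ ∀ k, (C * A ^ k) *ᵥ v = 0 := fun v =>
    LinearMap.mem_ker.trans (obsMatrix_mulVec_eq_zero_iff A C v)
  obtain ⟨W, hUW⟩ := Submodule.exists_isCompl U
  let bW := Module.finBasis ℝ W
  let bU := Module.finBasis ℝ U
  let b := (bW.prod bU).map (Submodule.prodEquivOfIsCompl W U hUW.symm)
  let T := (Pi.basisFun ℝ (Fin n)).toMatrix b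
  let S := b.toMatrix (Pi.basisFun ℝ (Fin n))
  have hTS : T * S = 1 := Module.Basis.toMatrix_mul_toMatrix_flip _ _
  have hST : S * T = 1 := Module.Basis.toMatrix_mul_toMatrix_flip _ _
  have hb1 : ∀ i, b (Sum.inl i) = bW i := fun i => by simp [b]
  have hb2 : ∀ i, b (Sum.inr i) = bU i := fun i => by simp [b]
  have hTcol : ∀ j, T.col j = b j := fun j => by funext i; simp [T, Module.Basis.toMatrix_apply]
  have hS : ∀ v, S *ᵥ v = b.repr v := fun v => by
    exact Module.Basis.toMatrix_mulVec_repr (Pi.basisFun ℝ (Fin n)) b v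
  have hinv : ∀ v ∈ U, A *ᵥ v ∈ U := fun v hv => by
    rw [memU] at hv ⊢
    intro k
    rw [Matrix.mulVec_mulVec, Matrix.mul_assoc, ← pow_succ]
    exact hv (k + 1)
  have hreprU : ∀ v ∈ U, ∀ i, b.repr v (Sum.inl i) = 0 := fun v hv i => by
    have : (Submodule.prodEquivOfIsCompl W U hUW.symm).symm v = (0, ⟨v, hv⟩) := by
      rw [LinearEquiv.symm_apply_eq]
      simp
    simp [b, this]
  have hst : S * A * T = fromBlocks (S * A * T).toBlocks₁₁ 0 (S * A * T).toBlocks₂₁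
      (S * A * T).toBlocks₂₂ := by
    have h12 : (S * A * T).toBlocks₁₂ = 0 := by
      ext i j
      have h1 : (S * A * T).col (Sum.inr j) = b.repr (A *ᵥ bU j) := by
        rw [← hb2, ← hTcol, ← hS, Matrix.mulVec_mulVec]
        rfl
      exact (congrFun h1 (Sum.inl i)).trans (hreprU _ (hinv _ (bU j).2) i)
    rw [← h12, fromBlocks_toBlocks]
  have hout : C * T = fromCols (C * T).toCols₁ 0 := by
    have h2 : (C * T).toCols₂ = 0 := by
      ext i j
      have h1 : (C * T).col (Sum.inr j) = 0 := by
        have h3 := (memU _).1 (bU j).2 0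
        rw [pow_zero, Matrix.mul_one, ← hb2, ← hTcol] at h3
        exact h3
      exact congrFun h1 i
    rw [← h2, fromCols_toCols]
  refine ⟨_, _, T, S, _, _, _, _, hTS, hST, hst, hout, ?_⟩
  have hZ := toRows₁_mul_of_state hTS hst
  have hC := eq_mul_toRows₁_of_mul_eq hTS hout
  have hZT := toRows₁_mul_toCols₁ hST
  refine (rank_eq_card_of_mulVec_eq_zero _ fun v hv => ?_).trans (Fintype.card_fin _)
  rw [obsMatrix_mulVec_eq_zero_iff] at hv
  have hZx : S.toRows₁ *ᵥ (T.toCols₁ *ᵥ v) = v := by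
    rw [Matrix.mulVec_mulVec, hZT, Matrix.one_mulVec]
  have hxU : T.toCols₁ *ᵥ v ∈ U := by
    rw [memU]
    intro k
    rw [mul_pow_eq_mul_pow_toRows₁ hZ hC k, ← Matrix.mulVec_mulVec, hZx]
    exact hv k
  have hxW : T.toCols₁ *ᵥ v ∈ W := by
    have : T.toCols₁ *ᵥ v = ∑ j, v j • b (Sum.inl j) := by
      funext i
      simp [Matrix.mulVec, dotProduct, ← hTcol, mul_comm]
    rw [this]
    refine Submodule.sum_mem _ fun j _ => Submodule.smul_mem _ _ ?_
    rw [hb1]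
    exact (bW j).2
  have hx0 : T.toCols₁ *ᵥ v = 0 := by
    have := hUW.inf_eq_bot ▸ Submodule.mem_inf.2 ⟨hxU, hxW⟩
    simpa using this
  rw [← hZx, hx0, Matrix.mulVec_zero]

/-- The last `l` columns of `T` are killed by the top rows of `S`, hence unobservable, hence
annihilated by the rows of `M`. -/
theorem mul_eq_fromCols_of_isKalmanObsDecomposition {ι : Type} {F : Matrix (Fin r) (Fin n) ℝ}
    (hFO : IsFunctionallyObservable A C F) (hd : IsKalmanObsDecomposition A C T S Ao A₂₁ Au Co)
    {M : Matrix ι (Fin n) ℝ} (hM : ∀ i, M i ∈ Submodule.span ℝ (Set.range (obsMatrix A F).row)) :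
    M * T = fromCols (M * T).toCols₁ 0 := by
  have hZ := toRows₁_mul_of_state hd.mul_inv hd.state
  have hC := eq_mul_toRows₁_of_mul_eq hd.mul_inv hd.output
  have h2 : (M * T).toCols₂ = 0 := by
    ext i j
    refine mulVec_eq_zero_of_isFunctionallyObservable hFO (hM i) (v := T.col (Sum.inr j)) ?_
    rw [obsMatrix_mulVec_eq_zero_iff]
    intro k
    have hcol : S.toRows₁ *ᵥ T.col (Sum.inr j) = 0 := by
      funext i
      have := congrFun (congrFun hd.inv_mul (Sum.inl i)) (Sum.inr j)
      rw [Matrix.one_apply_ne (by simp)] at this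
      exact this
    rw [mul_pow_eq_mul_pow_toRows₁ hZ hC k, ← Matrix.mulVec_mulVec, hcol, Matrix.mulVec_zero]
  rw [← h2, fromCols_toCols]

/-- The right inverse `Y` lets the common factor `Z` be dropped from every rank, and all ranks
become `h`. For the pencil, injectivity of `(Fz; Rz)` over `ℂ` turns a null vector into one with `Ao
v = s v` and `Co v = 0`. -/
theorem observerRankConditions_of_mul {ι : Type} [Fintype ι] {F : Matrix (Fin r) (Fin n) ℝ}
    {R : Matrix ι (Fin n) ℝ} {Fz : Matrix (Fin r) (Fin h) ℝ} {Rz : Matrix ι (Fin h) ℝ}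
    {Z : Matrix (Fin h) (Fin n) ℝ} {Y : Matrix (Fin n) (Fin h) ℝ} (hZY : Z * Y = 1)
    (hZ : Z * A = Ao * Z) (hC : C = Co * Z) (hF : F = Fz * Z) (hR : R = Rz * Z)
    (hinj : ∀ v, Fz *ᵥ v = 0 → Rz *ᵥ v = 0 → v = 0) (hobs : (obsMatrix Ao Co).rank = h) :
    ObserverRankConditions A C F R := by
  have hFA : F * A = (Fz * Ao) * Z := by rw [hF, Matrix.mul_assoc, hZ, Matrix.mul_assoc]
  have hRA : R * A = (Rz * Ao) * Z := by rw [hR, Matrix.mul_assoc, hZ, Matrix.mul_assoc]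
  have hCA : C * A = (Co * Ao) * Z := by rw [hC, Matrix.mul_assoc, hZ, Matrix.mul_assoc]
  have hrhs : (fromRows (C * A) (fromRows C (fromRows F R))).rank = h := by
    rw [hCA, hC, hF, hR, ← fromRows_mul, ← fromRows_mul, ← fromRows_mul,
      rank_mul_eq_left_of_mul_eq_one _ hZY]
    refine (rank_eq_card_of_mulVec_eq_zero _ fun v hv => ?_).trans (Fintype.card_fin _)
    simp only [fromRows_mulVec] at hv
    refine hinj v ?_ ?_
    · exact congrArg (fun w => w ∘ Sum.inr ∘ Sum.inr ∘ Sum.inl) hv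
    · exact congrArg (fun w => w ∘ Sum.inr ∘ Sum.inr ∘ Sum.inr) hv
  refine ⟨?_, fun s => ?_⟩
  · rw [hrhs, hFA, hRA, hCA, hC, hF, hR]
    simp only [← fromRows_mul]
    rw [rank_mul_eq_left_of_mul_eq_one _ hZY]
    refine (rank_eq_card_of_mulVec_eq_zero _ fun v hv => ?_).trans (Fintype.card_fin _)
    simp only [fromRows_mulVec] at hv
    refine hinj v ?_ ?_
    · exact congrArg (fun w => w ∘ Sum.inr ∘ Sum.inr ∘ Sum.inr ∘ Sum.inr ∘ Sum.inl) hv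
    · exact congrArg (fun w => w ∘ Sum.inr ∘ Sum.inr ∘ Sum.inr ∘ Sum.inr ∘ Sum.inr) hv
  · have hZYc : Z.map Complex.ofReal * Y.map Complex.ofReal = 1 := by
      rw [← map_ofReal_mul, hZY]
      exact Matrix.map_one _ Complex.ofReal_zero Complex.ofReal_one
    rw [hrhs, hFA, hRA, hCA, hC, hF, hR]
    simp only [map_ofReal_mul, ← Matrix.smul_mul, ← Matrix.sub_mul, ← fromRows_mul]
    rw [rank_mul_eq_left_of_mul_eq_one _ hZYc]
    refine (rank_eq_card_of_mulVec_eq_zero _ fun v hv => ?_).trans (Fintype.card_fin _)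
    simp only [fromRows_mulVec] at hv
    have h1 : (s • Fz.map Complex.ofReal - Fz.map Complex.ofReal * Ao.map Complex.ofReal) *ᵥ v = 0 :=
      congrArg (fun w => w ∘ Sum.inl) hv
    have h2 : (s • Rz.map Complex.ofReal - Rz.map Complex.ofReal * Ao.map Complex.ofReal) *ᵥ v = 0 :=
      congrArg (fun w => w ∘ Sum.inr ∘ Sum.inl) hv
    have h3 : Co.map Complex.ofReal *ᵥ v = 0 :=
      congrArg (fun w => w ∘ Sum.inr ∘ Sum.inr ∘ Sum.inr) hv
    refine eq_zero_of_kalman Ao Co (eq_zero_of_observable hobs) (s := s) ?_ h3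
    have h4 : s • v - Ao.map Complex.ofReal *ᵥ v = 0 := by
      refine eq_zero_of_forall_mulVec_map_ofReal (fun _ : Unit => fromRows Fz Rz)
        (fun w hw => ?_) fun _ => ?_
      · have hw := hw ()
        rw [fromRows_mulVec] at hw
        exact hinj w (congrArg (fun w => w ∘ Sum.inl) hw) (congrArg (fun w => w ∘ Sum.inr) hw)
      · have hmap : (fromRows Fz Rz).map Complex.ofReal =
            fromRows (Fz.map Complex.ofReal) (Rz.map Complex.ofReal) := by
          ext i j
          cases i <;> rfl
        rw [hmap, fromRows_mulVec]
        have e1 : Fz.map Complex.ofReal *ᵥ (s • v - Ao.map Complex.ofReal *ᵥ v) = 0 := by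
          rw [Matrix.mulVec_sub, Matrix.mulVec_smul, Matrix.mulVec_mulVec, ← h1, Matrix.sub_mulVec,
            Matrix.smul_mulVec]
        have e2 : Rz.map Complex.ofReal *ᵥ (s • v - Ao.map Complex.ofReal *ᵥ v) = 0 := by
          rw [Matrix.mulVec_sub, Matrix.mulVec_smul, Matrix.mulVec_mulVec, ← h2, Matrix.sub_mulVec,
            Matrix.smul_mulVec]
        rw [e1, e2]
        funext i
        cases i <;> rfl
    exact (sub_eq_zero.1 h4).symm

/-- A Luenberger observer of the observable part, whose design does not involve the input matrix. -/
theorem exists_isFunctionalObserver {ι : Type} {Z : Matrix (Fin h) (Fin n) ℝ}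
    (hZ : Z * A = Ao * Z) (hC : C = Co * Z) (hobs : (obsMatrix Ao Co).rank = h)
    {Fb : Matrix ι (Fin n) ℝ} {Fo : Matrix ι (Fin h) ℝ} (hF : Fb = Fo * Z) :
    ∃ (N : Matrix (Fin h) (Fin h) ℝ) (J : Matrix (Fin h) (Fin p) ℝ) (P : Matrix (Fin h) (Fin n) ℝ)
      (D : Matrix ι (Fin h) ℝ) (E : Matrix ι (Fin p) ℝ),
      ∀ (m' : ℕ) (B' : Matrix (Fin n) (Fin m') ℝ),
        IsFunctionalObserver A B' C Fb ⟨N, J, P * B', D, E⟩ := by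
  obtain ⟨L, hL⟩ := exists_stabilizing_injection Ao Co (eq_zero_of_observable hobs)
  -- The state `w` estimates `Z x`. With `H = Z B'` the input cancels from the error, which obeys
  -- `e' = (Ao - L Co) e` whatever `B'` is.
  refine ⟨Ao - L * Co, L, Z, Fo, 0, fun m' B' u x w _ hx hw => ?_⟩
  have he : Tendsto (fun t => w t - Z *ᵥ x t) atTop (𝓝 0) := by
    refine hL _ fun t ht => ?_
    refine ((hw t ht).sub (HasDerivWithinAt.const_mulVec Z (hx t ht))).congr_deriv ?_
    simp only [hC, Matrix.mulVec_add, Matrix.mulVec_mulVec, hZ, Matrix.mulVec_sub, Matrix.sub_mulVec,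
      Matrix.sub_mul, Matrix.mul_assoc]
    abel
  have hlim := tendsto_const_mulVec Fo he
  refine hlim.congr fun t => ?_
  simp [LinearObserver.estimate, hF, Matrix.mulVec_sub, Matrix.mulVec_mulVec]

end Kalman

/-! ### Assembling the explicit augmentations -/

section Construction

variable {n p r h l k₁ k₂ : ℕ} {A : Matrix (Fin n) (Fin n) ℝ} {C : Matrix (Fin p) (Fin n) ℝ}
  {T : Matrix (Fin n) (Fin h ⊕ Fin l) ℝ} {S : Matrix (Fin h ⊕ Fin l) (Fin n) ℝ}
  {Ao : Matrix (Fin h) (Fin h) ℝ} {A₂₁ : Matrix (Fin l) (Fin h) ℝ} {Au : Matrix (Fin l) (Fin l) ℝ}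
  {Co : Matrix (Fin p) (Fin h) ℝ}

theorem exists_isRowBasisCompletion (A : Matrix (Fin n) (Fin n) ℝ) (F : Matrix (Fin r) (Fin n) ℝ)
    (hF : F.rank = r) :
    ∃ (k₁ : ℕ) (R₁ : Matrix (Fin k₁) (Fin n) ℝ), IsRowBasisCompletion A F R₁ := by
  obtain ⟨k, σ, hσ⟩ := exists_rowsFormBasis_completion F (obsMatrix A F)
    (linearIndependent_row_of_rank F (by simpa using hF)) (row_mem_span_obsMatrix A F)
  exact ⟨k, _, ⟨σ, rfl⟩, hσ⟩

theorem RowsFormBasis.row_mem {ι : Type} {M : Matrix ι (Fin n) ℝ} {V : Submodule ℝ (Fin n → ℝ)}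
    (hM : RowsFormBasis M V) (i : ι) : M i ∈ V :=
  hM.2 ▸ Submodule.subset_span ⟨i, rfl⟩

theorem RowsFormBasis.finrank_eq {ι : Type} [Fintype ι] {M : Matrix ι (Fin n) ℝ}
    {V : Submodule ℝ (Fin n → ℝ)} (hM : RowsFormBasis M V) :
    Module.finrank ℝ V = Fintype.card ι := by
  rw [← hM.2, ← rank_eq_finrank_span_row, hM.1.rank_matrix]

theorem exists_rowsFormBasis_top {ι : Type} {M : Matrix ι (Fin n) ℝ}
    (hM : LinearIndependent ℝ M.row) :
    ∃ (k : ℕ) (P : Matrix (Fin k) (Fin n) ℝ), RowsFormBasis (fromRows M P) ⊤ := by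
  have htop : Submodule.span ℝ (Set.range (1 : Matrix (Fin n) (Fin n) ℝ).row) = ⊤ := by
    refine Submodule.eq_top_of_finrank_eq ?_
    rw [← rank_eq_finrank_span_row, rank_one, Module.finrank_fintype_fun_eq_card]
  obtain ⟨k, σ, hσ⟩ := exists_rowsFormBasis_completion M 1 hM fun i => htop ▸ Submodule.mem_top
  exact ⟨k, _, htop ▸ hσ⟩

theorem RowsFormBasis.eq_zero_of_mulVec {ι : Type} {M : Matrix ι (Fin n) ℝ}
    (hM : RowsFormBasis M ⊤) {v : Fin n → ℝ} (hv : M *ᵥ v = 0) : v = 0 := by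
  refine dotProduct_eq_zero v fun w => ?_
  have hw : w ∈ Submodule.span ℝ (Set.range M.row) := hM.2 ▸ Submodule.mem_top
  rw [dotProduct_comm]
  induction hw using Submodule.span_induction with
  | mem x hx =>
    obtain ⟨i, rfl⟩ := hx
    exact congrFun hv i
  | zero => exact zero_dotProduct _
  | add x y _ _ hx hy => rw [add_dotProduct, hx, hy, add_zero]
  | smul a x _ hx => rw [smul_dotProduct, hx, smul_zero]

theorem IsKalmanObsDecomposition.card_le (hd : IsKalmanObsDecomposition A C T S Ao A₂₁ Au Co) :
    h ≤ n := by
  have h1 : (S.toRows₁ * T.toCols₁).rank = h := by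
    rw [toRows₁_mul_toCols₁ hd.inv_mul, rank_one, Fintype.card_fin]
  exact h1 ▸ (rank_mul_le_left _ _).trans (rank_le_width _)

theorem linearIndependent_row_of_mul_eq_fromCols {ι : Type} [Fintype ι] (hTS : T * S = 1)
    {M : Matrix ι (Fin n) ℝ} {Mo : Matrix ι (Fin h) ℝ} (hM : M * T = fromCols Mo 0)
    (hLI : LinearIndependent ℝ M.row) : LinearIndependent ℝ Mo.row := by
  refine linearIndependent_row_of_rank _ (rank_eq_card_of_vecMul_eq_zero _ fun v hv => ?_)
  refine eq_zero_of_vecMul_eq_zero hLI ?_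
  rw [eq_mul_toRows₁_of_mul_eq hTS hM, ← Matrix.vecMul_vecMul, hv, Matrix.zero_vecMul]

theorem observerRankConditions_of_completion {F : Matrix (Fin r) (Fin n) ℝ}
    {R₁ : Matrix (Fin k₁) (Fin n) ℝ} (hd : IsKalmanObsDecomposition A C T S Ao A₂₁ Au Co)
    {Fo : Matrix (Fin r ⊕ Fin k₁) (Fin h) ℝ} (hFo : fromRows F R₁ * T = fromCols Fo 0)
    {Fp : Matrix (Fin k₂) (Fin h) ℝ} (hFp : RowsFormBasis (fromRows Fo Fp) ⊤) :
    ObserverRankConditions A C F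
      (fromRows R₁ ((fromCols Fp 0 : Matrix (Fin k₂) (Fin h ⊕ Fin l) ℝ) * S)) := by
  have hFb := eq_mul_toRows₁_of_mul_eq hd.mul_inv hFo
  have hF : F = Fo.toRows₁ * S.toRows₁ := congrArg toRows₁ hFb
  have hR₁ : R₁ = Fo.toRows₂ * S.toRows₁ := congrArg toRows₂ hFb
  have hR : fromRows R₁ ((fromCols Fp 0 : Matrix (Fin k₂) (Fin h ⊕ Fin l) ℝ) * S) =
      fromRows Fo.toRows₂ Fp * S.toRows₁ := by
    conv_lhs => rw [← fromRows_toRows S]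
    rw [fromRows_mul, fromCols_mul_fromRows, Matrix.zero_mul, add_zero, ← hR₁]
  refine observerRankConditions_of_mul (toRows₁_mul_toCols₁ hd.inv_mul)
    (toRows₁_mul_of_state hd.mul_inv hd.state) (eq_mul_toRows₁_of_mul_eq hd.mul_inv hd.output)
    hF hR (fun v h1 h2 => hFp.eq_zero_of_mulVec ?_) hd.observable
  rw [fromRows_mulVec] at h2
  rw [← fromRows_toRows Fo, fromRows_mulVec, fromRows_mulVec, h1]
  have h3 : Fo.toRows₂ *ᵥ v = 0 := congrArg (fun w => w ∘ Sum.inl) h2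
  have h4 : Fp *ᵥ v = 0 := congrArg (fun w => w ∘ Sum.inr) h2
  rw [h3, h4]
  funext i
  rcases i with (i | i) | i <;> rfl

end Construction

end GSP

/-- Generalized separation principle, with its constructive form. -/
theorem mainTheorem12 {n m p r : ℕ} (A : Matrix (Fin n) (Fin n) ℝ)
    (B : Matrix (Fin n) (Fin m) ℝ) (C : Matrix (Fin p) (Fin n) ℝ) (F : Matrix (Fin r) (Fin n) ℝ)
    (hF : F.rank = r) (hIFC : IsIntrinsicallyFunctionallyControllable A B F)
    (hFO : IsFunctionallyObservable A C F) :
    -- the augmentations exist, and satisfy all four rank conditions simultaneously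
    (∃ (k₁ k₂ : ℕ) (R₁ : Matrix (Fin k₁) (Fin n) ℝ) (R₂ : Matrix (Fin k₂) (Fin n) ℝ),
      r + (k₁ + k₂) ≤ n ∧ (fromRows F R₁).rank = r + k₁ ∧
      ControllerRankConditions A B (fromRows F R₁) ∧
      ObserverRankConditions A C F (fromRows R₁ R₂)) ∧
    -- the ingredients of the explicit construction exist
    (∃ (k₁ : ℕ) (R₁ : Matrix (Fin k₁) (Fin n) ℝ), IsRowBasisCompletion A F R₁) ∧
    (∃ (h l : ℕ) (T : Matrix (Fin n) (Fin h ⊕ Fin l) ℝ) (S : Matrix (Fin h ⊕ Fin l) (Fin n) ℝ)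
      (Ao : Matrix (Fin h) (Fin h) ℝ) (A₂₁ : Matrix (Fin l) (Fin h) ℝ)
      (Au : Matrix (Fin l) (Fin l) ℝ) (Co : Matrix (Fin p) (Fin h) ℝ),
      IsKalmanObsDecomposition A C T S Ao A₂₁ Au Co) ∧
    -- and every choice of them works
    (∀ (k₁ : ℕ) (R₁ : Matrix (Fin k₁) (Fin n) ℝ), IsRowBasisCompletion A F R₁ →
      ((fromRows F R₁).rank = r + k₁ ∧ Module.finrank ℝ (intrinsicSubspace A F) = r + k₁ ∧
        LinearMap.range (fromRows F R₁)ᵀ.mulVecLin = intrinsicSubspace A F ∧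
        ControllerRankConditions A B (fromRows F R₁)) ∧
      (∀ (h l : ℕ) (T : Matrix (Fin n) (Fin h ⊕ Fin l) ℝ)
        (S : Matrix (Fin h ⊕ Fin l) (Fin n) ℝ)
        (Ao : Matrix (Fin h) (Fin h) ℝ) (A₂₁ : Matrix (Fin l) (Fin h) ℝ)
        (Au : Matrix (Fin l) (Fin l) ℝ) (Co : Matrix (Fin p) (Fin h) ℝ),
        IsKalmanObsDecomposition A C T S Ao A₂₁ Au Co →
        ∃ Fo : Matrix (Fin r ⊕ Fin k₁) (Fin h) ℝ,
          fromRows F R₁ * T = fromCols Fo 0 ∧ Fo.rank = r + k₁ ∧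
          (∃ (k₂ : ℕ) (Fp : Matrix (Fin k₂) (Fin h) ℝ), RowsFormBasis (fromRows Fo Fp) ⊤) ∧
          ∀ (k₂ : ℕ) (Fp : Matrix (Fin k₂) (Fin h) ℝ), RowsFormBasis (fromRows Fo Fp) ⊤ →
            r + (k₁ + k₂) ≤ n ∧
            ObserverRankConditions A C F (fromRows R₁ (fromCols Fp 0 * S)) ∧
            -- a functional observer of order `r + k₁ + k₂`, whose design does not use `B`:
            -- the input matrix enters through its input channel `P * B'` only
            ∃ (N : Matrix (Fin (r + (k₁ + k₂))) (Fin (r + (k₁ + k₂))) ℝ)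
              (J : Matrix (Fin (r + (k₁ + k₂))) (Fin p) ℝ)
              (P : Matrix (Fin (r + (k₁ + k₂))) (Fin n) ℝ)
              (D : Matrix (Fin r ⊕ Fin k₁) (Fin (r + (k₁ + k₂))) ℝ)
              (E : Matrix (Fin r ⊕ Fin k₁) (Fin p) ℝ),
              ∀ (m' : ℕ) (B' : Matrix (Fin n) (Fin m') ℝ),
                IsFunctionalObserver A B' C (fromRows F R₁) ⟨N, J, P * B', D, E⟩) ∧
      -- a controller gain exists, whose design does not use `C`
      (∃ K : Matrix (Fin m) (Fin r ⊕ Fin k₁) ℝ,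
        IsFunctionalController A B (fromRows F R₁) K) ∧
      -- every controller gain can be combined with every functional observer
      (∀ (K : Matrix (Fin m) (Fin r ⊕ Fin k₁) ℝ) (q : ℕ)
        (O : LinearObserver q p m (Fin r ⊕ Fin k₁)),
        IsFunctionalController A B (fromRows F R₁) K →
        IsFunctionalObserver A B C (fromRows F R₁) O →
        (∀ (x₀ : Fin n → ℝ) (w₀ : Fin q → ℝ), ∃ (x : ℝ → Fin n → ℝ) (w : ℝ → Fin q → ℝ),
          x 0 = x₀ ∧ w 0 = w₀ ∧ IsClosedLoopSolution A B C K O x w) ∧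
        ∀ (x : ℝ → Fin n → ℝ) (w : ℝ → Fin q → ℝ), IsClosedLoopSolution A B C K O x w →
          Tendsto (fun t => F *ᵥ x t) atTop (𝓝 0))) := by
  have hbasis : ∀ (k₁ : ℕ) (R₁ : Matrix (Fin k₁) (Fin n) ℝ), IsRowBasisCompletion A F R₁ →
      (fromRows F R₁).rank = r + k₁ := fun k₁ R₁ hR => by
    simpa using hR.2.1.rank_matrix
  have hobserver : ∀ (k₁ : ℕ) (R₁ : Matrix (Fin k₁) (Fin n) ℝ), IsRowBasisCompletion A F R₁ →
      ∀ (h l : ℕ) (T : Matrix (Fin n) (Fin h ⊕ Fin l) ℝ) (S : Matrix (Fin h ⊕ Fin l) (Fin n) ℝ)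
        (Ao : Matrix (Fin h) (Fin h) ℝ) (A₂₁ : Matrix (Fin l) (Fin h) ℝ)
        (Au : Matrix (Fin l) (Fin l) ℝ) (Co : Matrix (Fin p) (Fin h) ℝ),
        IsKalmanObsDecomposition A C T S Ao A₂₁ Au Co →
        ∃ Fo : Matrix (Fin r ⊕ Fin k₁) (Fin h) ℝ,
          fromRows F R₁ * T = fromCols Fo 0 ∧ Fo.rank = r + k₁ ∧
          (∃ (k₂ : ℕ) (Fp : Matrix (Fin k₂) (Fin h) ℝ), RowsFormBasis (fromRows Fo Fp) ⊤) ∧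
          ∀ (k₂ : ℕ) (Fp : Matrix (Fin k₂) (Fin h) ℝ), RowsFormBasis (fromRows Fo Fp) ⊤ →
            r + (k₁ + k₂) ≤ n ∧
            ObserverRankConditions A C F (fromRows R₁ (fromCols Fp 0 * S)) ∧
            ∃ (N : Matrix (Fin (r + (k₁ + k₂))) (Fin (r + (k₁ + k₂))) ℝ)
              (J : Matrix (Fin (r + (k₁ + k₂))) (Fin p) ℝ)
              (P : Matrix (Fin (r + (k₁ + k₂))) (Fin n) ℝ)
              (D : Matrix (Fin r ⊕ Fin k₁) (Fin (r + (k₁ + k₂))) ℝ)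
              (E : Matrix (Fin r ⊕ Fin k₁) (Fin p) ℝ),
              ∀ (m' : ℕ) (B' : Matrix (Fin n) (Fin m') ℝ),
                IsFunctionalObserver A B' C (fromRows F R₁) ⟨N, J, P * B', D, E⟩ := by
    intro k₁ R₁ hR h l T S Ao A₂₁ Au Co hd
    have hFo := mul_eq_fromCols_of_isKalmanObsDecomposition hFO hd hR.2.row_mem
    have hLI := linearIndependent_row_of_mul_eq_fromCols hd.mul_inv hFo hR.2.1
    refine ⟨_, hFo, by simpa using hLI.rank_matrix, exists_rowsFormBasis_top hLI,
      fun k₂ Fp hFp => ?_⟩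
    -- The completed rows form a basis of `ℝ^h`, so their number, the prescribed observer order, is
    -- the dimension of the observable part.
    have hh : h = r + (k₁ + k₂) := by
      have := hFp.finrank_eq
      rw [finrank_top, Module.finrank_fintype_fun_eq_card] at this
      simpa [add_assoc] using this
    subst hh
    exact ⟨hd.card_le, observerRankConditions_of_completion hd hFo hFp,
      exists_isFunctionalObserver (toRows₁_mul_of_state hd.mul_inv hd.state)
        (eq_mul_toRows₁_of_mul_eq hd.mul_inv hd.output) hd.observable
        (eq_mul_toRows₁_of_mul_eq hd.mul_inv hFo)⟩
  have hcompl := exists_isRowBasisCompletion A F hF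
  have hkalman := exists_isKalmanObsDecomposition A C
  refine ⟨?_, hcompl, hkalman, fun k₁ R₁ hR => ⟨⟨hbasis k₁ R₁ hR, ?_, ?_, ?_⟩, hobserver k₁ R₁ hR,
    ?_, fun K q O hK hO => ⟨exists_isClosedLoopSolution A B C K O, fun x w hxw => ?_⟩⟩⟩
  · obtain ⟨k₁, R₁, hR⟩ := hcompl
    obtain ⟨h, l, T, S, Ao, A₂₁, Au, Co, hd⟩ := hkalman
    obtain ⟨Fo, -, -, ⟨k₂, Fp, hFp⟩, hall⟩ := hobserver k₁ R₁ hR h l T S Ao A₂₁ Au Co hd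
    obtain ⟨hle, hobs, -⟩ := hall k₂ Fp hFp
    exact ⟨k₁, k₂, R₁, _, hle, hbasis k₁ R₁ hR, controllerRankConditions_of_span_eq hIFC hR.2, hobs⟩
  · rw [intrinsicSubspace_eq_span, hR.2.finrank_eq]
    simp
  · rw [intrinsicSubspace_eq_span, Matrix.range_mulVecLin]
    exact hR.2.2
  · exact controllerRankConditions_of_span_eq hIFC hR.2
  · exact exists_isFunctionalController hR.2.1 (controllerRankConditions_of_span_eq hIFC hR.2)
  · obtain ⟨M, hM⟩ := exists_mul_eq_of_controllerRankConditions
      (controllerRankConditions_of_span_eq hIFC hR.2)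
    have hlim := tendsto_zero_of_isClosedLoopSolution hM hR.2.1 hK hO hxw
    refine tendsto_pi_nhds.2 fun i => ?_
    exact tendsto_pi_nhds.1 hlim (Sum.inl i)
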